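/- **Definitions.** A *map* is a continuous function. A *disk-hedgehog* is a space homeomorphic to a directed wedge $Z=\bigvee_{s\in S}(D_s,z_s)$ of $2$-disks $D_s\cong D^2$ with arbitrary base points $z_s\in D_s$, indexed by a nonempty directed set $S$, where a set $U\subset Z$ is open if and only if $U\cap D_s$ is open in $D_s$ for every $s\in S$ and, in case $U$ contains the base point $z_0$ of $Z$, there is $t\in S$ such that $D_s\subset U$ for all $s>t$. A map $p:E\to B$ is a *disk-hedgehog covering* if for every disk-hedgehog $H$, every $x_0\in H$, every $e_0\in E$ and every map $f:H\to B$ with $f(x_0)=p(e_0)$ there is a map $g:H\to E$ with $p\circ g=f$ and $g(x_0)=e_0$, and if any two maps $g,h:H\to E$ with $p\circ g=p\circ h$ that agree at some point of $H$ are equal. A *Peano space* is a connected and locally path-connected space. Let $B$ be a path-connected space. A disk-hedgehog covering $p:E\to B$ with $E$ Peano is *maximal* if for every disk-hedgehog covering $q:E'\to B$ with $E'$ Peano and all $e\in E$, $e'\in E'$ with $p(e)=q(e')$ there is a map $f:E\to E'$ with $q\circ f=p$ and $f(e)=e'$. A maximal covering exists and is unique up to a homeomorphism over $B$. For $b_0\in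 B$ the *hedgehog fundamental group* $\pi(B,b_0)$ is the monodromy group at $b_0$ of the maximal covering $p:E\to B$: its elements are the equivalence classes of loops in $B$ at $b_0$, where $\alpha\sim\beta$ if any lifts $\tilde\alpha,\tilde\beta:[0,1]\to E$ of $\alpha,\beta$ with $\tilde\alpha(0)=\tilde\beta(0)$ satisfy $\tilde\alpha(1)=\tilde\beta(1)$, and the operation is induced by concatenation. A map $f:B_1\to B_2$ of path-connected spaces induces the homomorphism $\pi(B_1,b_1)\to\pi(B_2,f(b_1))$, $[\alpha]\mapsto[f\circ\alpha]$. For a family $\mathcal U$ of subsets of $B$ and $x\in B$, the *star* $st(x,\mathcal U)$ is the union of all members of $\mathcal U$ that contain $x$. The *nerve* of $\mathcal U$ is the simplicial complex whose vertices are the members of $\mathcal U$ and whose simplices are the nonempty finite subsets of $\mathcal U$ with nonempty intersection; its fundamental group is that of its geometric realization with the weak topology. **Theorem.** Let $B$ be a path-connected paracompact space and let $\mathcal U$ be an open cover of $B$ consisting of (nonempty) path-connected sets. Suppose that for each $x\in B$ the homomorphism $\pi(st(x,\mathcal U),x)\to\pi(B,x)$ induced by the inclusion $st(x,\mathcal U)\to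 B$ is trivial. Then, for every $b_0\in B$ and every base point $v$ of the geometric realization of the nerve of $\mathcal U$, the group $\pi(B,b_0)$ is isomorphic to the fundamental group of the nerve of $\mathcal U$ at $v$. -/

import Mathlib

open Topology Set unitInterval

universe u v w

namespace Hedgehog

/-! ### Directed wedges and disk-hedgehogs -/

/-- Two points of the disjoint union of the pointed spaces `(Z s, z s)` are identified in the wedge
if they are equal or both are base points. -/
def wedgeSetoid {S : Type u} (Z : S → Type v) (z : ∀ s, Z s) : Setoid (Σ s, Z s) where
  r a b := a = b ∨ (a.2 = z a.1 ∧ b.2 = z b.1)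
  iseqv :=
    { refl := fun _ => Or.inl rfl
      symm := fun h => h.elim (fun e => Or.inl e.symm) (fun e => Or.inr ⟨e.2, e.1⟩)
      trans := by
        rintro a b c (rfl | h) (rfl | h')
        · exact Or.inl rfl
        · exact Or.inr h'
        · exact Or.inr h
        · exact Or.inr ⟨h.1, h'.2⟩ }

/-- The underlying set of the wedge of the pointed spaces `(Z s, z s)`. -/
def DirectedWedge {S : Type u} (Z : S → Type v) (z : ∀ s, Z s) : Type (max u v) :=
  Quotient (wedgeSetoid Z z)

namespace DirectedWedge

/-- The inclusion of the summand `Z s` into the wedge. -/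
def incl {S : Type u} (Z : S → Type v) (z : ∀ s, Z s) (s : S) (x : Z s) : DirectedWedge Z z :=
  Quotient.mk (wedgeSetoid Z z) ⟨s, x⟩

theorem incl_base {S : Type u} (Z : S → Type v) (z : ∀ s, Z s) (s t : S) :
    incl Z z s (z s) = incl Z z t (z t) :=
  Quotient.sound (s := wedgeSetoid Z z) (Or.inr ⟨rfl, rfl⟩)

theorem exists_incl {S : Type u} {Z : S → Type v} {z : ∀ s, Z s} (x : DirectedWedge Z z) :
    ∃ s y, incl Z z s y = x := by
  obtain ⟨⟨s, y⟩, rfl⟩ := Quotient.exists_rep (s := wedgeSetoid Z z) x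
  exact ⟨s, y, rfl⟩

/-- The topology of the directed wedge: `U` is open if and only if `U ∩ Z s` is open for all `s`
and, in case `U` contains the base point, there is `t` with `Z s ⊆ U` for all `s > t`. -/
instance {S : Type u} [Preorder S] [IsDirectedOrder S] (Z : S → Type v)
    [∀ s, TopologicalSpace (Z s)] (z : ∀ s, Z s) : TopologicalSpace (DirectedWedge Z z) where
  IsOpen U := (∀ s, IsOpen (incl Z z s ⁻¹' U)) ∧
    ∀ i, incl Z z i (z i) ∈ U → ∃ t, ∀ s, t < s → ∀ x : Z s, incl Z z s x ∈ U
  isOpen_univ := ⟨fun _ => isOpen_univ, fun i _ => ⟨i, fun _ _ _ => mem_univ _⟩⟩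
  isOpen_inter := by
    rintro U V ⟨hU, hU'⟩ ⟨hV, hV'⟩
    refine ⟨fun s => (hU s).inter (hV s), fun i hi => ?_⟩
    obtain ⟨t, ht⟩ := hU' i hi.1
    obtain ⟨t', ht'⟩ := hV' i hi.2
    obtain ⟨r, hr, hr'⟩ := exists_ge_ge t t'
    exact ⟨r, fun s hs x => ⟨ht s (hr.trans_lt hs) x, ht' s (hr'.trans_lt hs) x⟩⟩
  isOpen_sUnion := by
    intro A hA
    refine ⟨fun s => ?_, ?_⟩
    · rw [preimage_sUnion]
      exact isOpen_biUnion fun U hU => (hA U hU).1 s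
    · rintro i ⟨U, hU, hi⟩
      obtain ⟨t, ht⟩ := (hA U hU).2 i hi
      exact ⟨t, fun s hs x => ⟨U, hU, ht s hs x⟩⟩

section
variable {S : Type u} [Preorder S] [IsDirectedOrder S] {Z : S → Type v}
  [∀ s, TopologicalSpace (Z s)] {z : ∀ s, Z s}

theorem isOpen_iff {U : Set (DirectedWedge Z z)} : IsOpen U ↔
    (∀ s, IsOpen (incl Z z s ⁻¹' U)) ∧
    ∀ i, incl Z z i (z i) ∈ U → ∃ t, ∀ s, t < s → ∀ x : Z s, incl Z z s x ∈ U := Iff.rfl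

theorem continuous_incl (s : S) : Continuous (incl Z z s) :=
  ⟨fun _ hU => (isOpen_iff.1 hU).1 s⟩

theorem pathConnectedSpace [Nonempty S] [∀ s, PathConnectedSpace (Z s)] :
    PathConnectedSpace (DirectedWedge Z z) := by
  obtain ⟨i⟩ := ‹Nonempty S›
  have key : ∀ x : DirectedWedge Z z, Joined (incl Z z i (z i)) x := by
    intro x
    obtain ⟨s, y, rfl⟩ := exists_incl x
    rw [incl_base Z z i s]
    exact (PathConnectedSpace.joined (z s) y).map (continuous_incl s)
  exact ⟨⟨incl Z z i (z i)⟩, fun x y => (key x).symm.trans (key y)⟩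
end

end DirectedWedge

/-- The unit disk `D²`. -/
abbrev UnitDisk : Type := Metric.closedBall (0 : EuclideanSpace ℝ (Fin 2)) 1

/-- A disk-hedgehog is a space homeomorphic to a directed wedge of `2`-disks, with arbitrary base
points in the disks, over a (nonempty) directed set. -/
def IsDiskHedgehog (X : Type u) [TopologicalSpace X] : Prop :=
  ∃ (S : Type u) (_ : Preorder S) (_ : IsDirectedOrder S) (_ : Nonempty S) (z : S → UnitDisk),
    Nonempty (X ≃ₜ DirectedWedge (fun _ : S => UnitDisk) z)

/-- The class of spaces homeomorphic to the unit interval. -/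
def IsArc (X : Type) [TopologicalSpace X] : Prop := Nonempty (X ≃ₜ I)

/-! ### Coverings defined by unique lifting -/

/-- The lifting property of `p` with respect to a class `P` of spaces. -/
def LiftingProperty (P : ∀ (X : Type w) [TopologicalSpace X], Prop) {E : Type v} {B : Type u}
    [TopologicalSpace E] [TopologicalSpace B] (p : E → B) : Prop :=
  ∀ (X : Type w) [TopologicalSpace X], P X → ∀ (f : C(X, B)) (x₀ : X) (e₀ : E), f x₀ = p e₀ →
    ∃ g : C(X, E), (∀ x, p (g x) = f x) ∧ g x₀ = e₀

/-- A map `p` is a `P`-covering if it has the lifting property for the class `P` and the lifts are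
unique. -/
structure IsCovering (P : ∀ (X : Type w) [TopologicalSpace X], Prop) {E : Type v} {B : Type u}
    [TopologicalSpace E] [TopologicalSpace B] (p : E → B) : Prop where
  continuous : Continuous p
  lifting : LiftingProperty P p
  unique : ∀ (X : Type w) [TopologicalSpace X], P X → ∀ (g h : C(X, E)),
    (∀ x, p (g x) = p (h x)) → (∃ x₀, g x₀ = h x₀) → g = h

/-- An arc-covering. -/
abbrev IsArcCovering {E : Type v} {B : Type u} [TopologicalSpace E] [TopologicalSpace B]
    (p : E → B) : Prop := IsCovering IsArc p

/-- A disk-hedgehog covering; the disk-hedgehogs range over the directed sets in the universe of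
the base space. -/
abbrev IsDiskHedgehogCovering {E : Type v} {B : Type u} [TopologicalSpace E] [TopologicalSpace B]
    (p : E → B) : Prop := IsCovering IsDiskHedgehog.{u} p

/-- A Peano space is a connected and locally path-connected space. -/
structure IsPeano (X : Type u) [TopologicalSpace X] : Prop where
  connected : ConnectedSpace X
  locallyPathConnected : LocallyPathConnectedSpace X

/-! ### Elementary facts on disks, hedgehogs and coverings -/

theorem pathConnectedSpace_unitDisk : PathConnectedSpace UnitDisk :=
  isPathConnected_iff_pathConnectedSpace.1
    ((convex_closedBall _ _).isPathConnected ⟨0, by simp⟩)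

theorem locallyPathConnectedSpace_unitDisk : LocallyPathConnectedSpace UnitDisk :=
  (convex_closedBall _ _).locallyPathConnectedSpace

theorem IsDiskHedgehog.pathConnectedSpace {X : Type u} [TopologicalSpace X]
    (h : IsDiskHedgehog X) : PathConnectedSpace X := by
  obtain ⟨S, _, _, _, z, ⟨φ⟩⟩ := h
  have := pathConnectedSpace_unitDisk
  have := DirectedWedge.pathConnectedSpace (Z := fun _ : S => UnitDisk) (z := z)
  exact φ.symm.surjective.pathConnectedSpace φ.symm.continuous

/-- The unit interval is a retract of some disk-hedgehog. -/
theorem exists_retract : ∃ (H : Type u) (_ : TopologicalSpace H) (r : C(H, I)) (i : C(I, H)),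
    IsDiskHedgehog H ∧ ∀ t, r (i t) = t := by
  let S : Type u := PUnit
  let z : S → UnitDisk := fun _ => ⟨0, by simp⟩
  let H := DirectedWedge (fun _ : S => UnitDisk) z
  let fold : H → UnitDisk := Quotient.lift (fun a => a.2) (by
    rintro ⟨⟨⟩, a⟩ ⟨⟨⟩, b⟩ (h | h)
    · rw [h]
    · exact h.1.trans h.2.symm)
  have hfold : Continuous fold := by
    refine ⟨fun U hU => DirectedWedge.isOpen_iff.2 ⟨fun s => hU, fun i _ => ⟨i, fun s hs => ?_⟩⟩⟩
    exact absurd hs (by cases s; cases i; exact lt_irrefl _)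
  let j : I → UnitDisk := fun t => ⟨EuclideanSpace.single 0 (t : ℝ), by
    simpa [abs_of_nonneg t.2.1] using t.2.2⟩
  have hj : Continuous j := by
    refine Continuous.subtype_mk ?_ _
    exact (PiLp.continuous_toLp 2 _).comp
      (continuous_pi fun k => by
        by_cases hk : k = 0
        · subst hk; simpa using continuous_subtype_val
        · simpa [hk] using continuous_const)
  let r : UnitDisk → I := fun x => projIcc 0 1 zero_le_one ((x : EuclideanSpace ℝ (Fin 2)) 0)
  have hr : Continuous r := by
    refine continuous_projIcc.comp ?_
    fun_prop
  refine ⟨H, inferInstance, ⟨r ∘ fold, hr.comp hfold⟩,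
    ⟨fun t => DirectedWedge.incl _ z PUnit.unit (j t),
      (DirectedWedge.continuous_incl _).comp hj⟩, ?_, ?_⟩
  · exact ⟨S, inferInstance, inferInstance, inferInstance, z, ⟨Homeomorph.refl _⟩⟩
  · intro t
    change r (j t) = t
    simp [r, j, projIcc_of_mem zero_le_one t.2]

theorem isArc_unitInterval : IsArc I := ⟨Homeomorph.refl _⟩

section arc
variable {E : Type v} {B : Type u} [TopologicalSpace E] [TopologicalSpace B] {p : E → B}

/-- Disk-hedgehog coverings are arc-coverings. -/
theorem IsCovering.isArcCovering (hp : IsDiskHedgehogCovering p) : IsArcCovering p := by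
  obtain ⟨H, _, r, i, hH, hri⟩ := exists_retract.{u}
  refine ⟨hp.continuous, ?_, ?_⟩
  · rintro X _ ⟨φ⟩ f x₀ e₀ h
    obtain ⟨g, hg, hg'⟩ := hp.lifting H hH
      (f.comp (⟨φ.symm, φ.symm.continuous⟩ : C(I, X)) |>.comp r) (i (φ x₀)) e₀ (by simpa [hri])
    exact ⟨(g.comp i).comp ⟨φ, φ.continuous⟩, fun x => by simp [hg, hri], by simpa using hg'⟩
  · rintro X _ ⟨φ⟩ g h hgh ⟨x₀, hx⟩
    have := hp.unique H hH (g.comp (⟨φ.symm, φ.symm.continuous⟩ : C(I, X)) |>.comp r)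
      (h.comp (⟨φ.symm, φ.symm.continuous⟩ : C(I, X)) |>.comp r) (fun x => by simp [hgh])
      ⟨i (φ x₀), by simp [hri, hx]⟩
    ext x
    have := congrArg (fun k => k (i (φ x))) this
    simpa [hri] using this

/-- `PathLifts p α x y`: some lift of the path `α` starts at `x` and ends at `y`. -/
def PathLifts (p : E → B) {b c : B} (α : Path b c) (x y : E) : Prop :=
  ∃ a : Path x y, ∀ t, p (a t) = α t

theorem IsArcCovering.exists_pathLifts (hp : IsArcCovering p) {b c : B} (α : Path b c) {x : E}
    (hx : p x = b) : ∃ y, PathLifts p α x y := by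
  obtain ⟨g, hg, hg'⟩ := hp.lifting I isArc_unitInterval α.toContinuousMap 0 x (by simp [hx])
  exact ⟨g 1, ⟨g, hg', rfl⟩, hg⟩

theorem PathLifts.source {b c : B} {α : Path b c} {x y : E} (h : PathLifts p α x y) :
    p x = b := by
  obtain ⟨a, ha⟩ := h
  simpa using ha 0

theorem PathLifts.target {b c : B} {α : Path b c} {x y : E} (h : PathLifts p α x y) :
    p y = c := by
  obtain ⟨a, ha⟩ := h
  simpa using ha 1

theorem IsArcCovering.pathLifts_unique (hp : IsArcCovering p) {b c : B} {α : Path b c} {x y y' : E}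
    (h : PathLifts p α x y) (h' : PathLifts p α x y') : y = y' := by
  obtain ⟨a, ha⟩ := h
  obtain ⟨a', ha'⟩ := h'
  have := hp.unique I isArc_unitInterval a.toContinuousMap a'.toContinuousMap
    (fun t => (ha t).trans (ha' t).symm) ⟨0, by simp⟩
  simpa using congrArg (fun k : C(I, E) => k 1) this

theorem pathLifts_refl {x : E} {b : B} (hx : p x = b) : PathLifts p (Path.refl b) x x :=
  ⟨Path.refl x, fun _ => by simpa using hx⟩

theorem PathLifts.symm {b c : B} {α : Path b c} {x y : E} (h : PathLifts p α x y) :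
    PathLifts p α.symm y x := by
  obtain ⟨a, ha⟩ := h
  exact ⟨a.symm, fun t => by simp [Path.symm_apply, ha]⟩

theorem PathLifts.trans {b c d : B} {α : Path b c} {β : Path c d} {x y z : E}
    (h : PathLifts p α x y) (h' : PathLifts p β y z) : PathLifts p (α.trans β) x z := by
  obtain ⟨a, ha⟩ := h
  obtain ⟨a', ha'⟩ := h'
  refine ⟨a.trans a', fun t => ?_⟩
  rw [Path.trans_apply, Path.trans_apply]
  split_ifs
  · exact ha _
  · exact ha' _

theorem IsArcCovering.pathLifts_trans_iff (hp : IsArcCovering p) {b c d : B} {α : Path b c}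
    {β : Path c d} {x z : E} :
    PathLifts p (α.trans β) x z ↔ ∃ y, PathLifts p α x y ∧ PathLifts p β y z := by
  refine ⟨fun h => ?_, fun ⟨y, h, h'⟩ => h.trans h'⟩
  obtain ⟨y, hy⟩ := hp.exists_pathLifts α h.source
  obtain ⟨z', hz⟩ := hp.exists_pathLifts β hy.target
  exact ⟨y, hy, hp.pathLifts_unique h (hy.trans hz) ▸ hz⟩

theorem pathLifts_symm_iff {b c : B} {α : Path b c} {x y : E} :
    PathLifts p α.symm x y ↔ PathLifts p α y x :=
  ⟨fun h => by simpa using h.symm, fun h => h.symm⟩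

/-! ### The monodromy group -/

/-- Two loops are equivalent with respect to `p` if any two lifts of them that have the same
initial point have the same terminal point. -/
def MonodromyRel (p : E → B) {b₀ : B} (α β : Path b₀ b₀) : Prop :=
  ∀ a b : C(I, E), (∀ t, p (a t) = α t) → (∀ t, p (b t) = β t) → a 0 = b 0 → a 1 = b 1

theorem monodromyRel_iff (p : E → B) {b₀ : B} (α β : Path b₀ b₀) : MonodromyRel p α β ↔
    ∀ x y y', PathLifts p α x y → PathLifts p β x y' → y = y' := by
  constructor
  · rintro h x y y' ⟨a, ha⟩ ⟨b, hb⟩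
    simpa using h a.toContinuousMap b.toContinuousMap ha hb (by simp)
  · intro h a b ha hb hab
    exact h (a 0) (a 1) (b 1) ⟨⟨a, rfl, rfl⟩, ha⟩ ⟨⟨b, hab.symm, rfl⟩, hb⟩

theorem IsArcCovering.monodromyRel_iff (hp : IsArcCovering p) {b₀ : B} (α β : Path b₀ b₀) :
    MonodromyRel p α β ↔ ∀ x y, PathLifts p α x y ↔ PathLifts p β x y := by
  rw [Hedgehog.monodromyRel_iff]
  constructor
  · intro h x y
    constructor
    · intro hy
      obtain ⟨y', hy'⟩ := hp.exists_pathLifts β hy.source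
      exact h x y y' hy hy' ▸ hy'
    · intro hy
      obtain ⟨y', hy'⟩ := hp.exists_pathLifts α hy.source
      exact h x y' y hy' hy ▸ hy'
  · intro h x y y' hy hy'
    exact hp.pathLifts_unique ((h x y).1 hy) hy'

/-- The equivalence relation on loops that defines the monodromy group. -/
def monodromySetoid (hp : IsArcCovering p) (b₀ : B) : Setoid (Path b₀ b₀) where
  r := MonodromyRel p
  iseqv :=
    { refl := fun α => (hp.monodromyRel_iff α α).2 fun _ _ => Iff.rfl
      symm := fun h => (hp.monodromyRel_iff _ _).2 fun x y =>
        ((hp.monodromyRel_iff _ _).1 h x y).symm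
      trans := fun h h' => (hp.monodromyRel_iff _ _).2 fun x y =>
        ((hp.monodromyRel_iff _ _).1 h x y).trans ((hp.monodromyRel_iff _ _).1 h' x y) }

/-- The monodromy group `π(p, b₀)` of an arc-covering `p`: the set of equivalence classes of loops
at `b₀`. -/
def MonodromyGroup (hp : IsArcCovering p) (b₀ : B) : Type u :=
  Quotient (monodromySetoid hp b₀)

/-- The class of a loop in the monodromy group. -/
def MonodromyGroup.mk (hp : IsArcCovering p) {b₀ : B} (α : Path b₀ b₀) : MonodromyGroup hp b₀ :=
  Quotient.mk (monodromySetoid hp b₀) α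

theorem MonodromyGroup.mk_eq_mk (hp : IsArcCovering p) {b₀ : B} {α β : Path b₀ b₀} :
    MonodromyGroup.mk hp α = MonodromyGroup.mk hp β ↔ MonodromyRel p α β :=
  Quotient.eq (r := monodromySetoid hp b₀)

/-- The group operation of the monodromy group is induced by concatenation, inverses are given by
reversed loops and the neutral element is the class of the constant loop. -/
noncomputable instance (hp : IsArcCovering p) (b₀ : B) : Group (MonodromyGroup hp b₀) where
  mul := Quotient.map₂ Path.trans (by
    intro α α' h β β' h'
    have h := (hp.monodromyRel_iff _ _).1 h
    have h' := (hp.monodromyRel_iff _ _).1 h'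
    exact (hp.monodromyRel_iff _ _).2 fun x y => by simp only [hp.pathLifts_trans_iff, h, h'])
  one := MonodromyGroup.mk hp (Path.refl b₀)
  inv := Quotient.map Path.symm (by
    intro α α' h
    have h := (hp.monodromyRel_iff _ _).1 h
    exact (hp.monodromyRel_iff _ _).2 fun x y => by simp only [pathLifts_symm_iff, h])
  mul_assoc := by
    rintro ⟨α⟩ ⟨β⟩ ⟨γ⟩
    refine (MonodromyGroup.mk_eq_mk hp).2 ((hp.monodromyRel_iff _ _).2 fun x y => ?_)
    simp only [hp.pathLifts_trans_iff]
    exact ⟨fun ⟨z, ⟨t, h₁, h₂⟩, h₃⟩ => ⟨t, h₁, z, h₂, h₃⟩,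
      fun ⟨t, h₁, z, h₂, h₃⟩ => ⟨z, ⟨t, h₁, h₂⟩, h₃⟩⟩
  one_mul := by
    rintro ⟨α⟩
    refine (MonodromyGroup.mk_eq_mk hp).2 ((monodromyRel_iff _ _ _).2 fun x y y' h h' => ?_)
    exact hp.pathLifts_unique h ((pathLifts_refl h.source).trans h')
  mul_one := by
    rintro ⟨α⟩
    refine (MonodromyGroup.mk_eq_mk hp).2 ((monodromyRel_iff _ _ _).2 fun x y y' h h' => ?_)
    exact hp.pathLifts_unique h (h'.trans (pathLifts_refl h'.target))
  inv_mul_cancel := by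
    rintro ⟨α⟩
    refine (MonodromyGroup.mk_eq_mk hp).2 ((monodromyRel_iff _ _ _).2 fun x y y' h h' => ?_)
    obtain ⟨z, hz, hz'⟩ := hp.pathLifts_trans_iff.1 h
    have h₁ := hp.pathLifts_unique hz' (pathLifts_symm_iff.1 hz)
    exact h₁.trans (hp.pathLifts_unique (pathLifts_refl h.source) h')

theorem MonodromyGroup.mk_trans (hp : IsArcCovering p) {b₀ : B} (α β : Path b₀ b₀) :
    MonodromyGroup.mk hp (α.trans β) = MonodromyGroup.mk hp α * MonodromyGroup.mk hp β := rfl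

theorem IsArcCovering.surjective [PathConnectedSpace B] [Nonempty E] (hp : IsArcCovering p) :
    Function.Surjective p := by
  intro b
  obtain ⟨e⟩ := ‹Nonempty E›
  obtain ⟨y, hy⟩ := hp.exists_pathLifts (PathConnectedSpace.somePath (p e) b) rfl
  exact ⟨y, hy.target⟩

end arc

/-! ### Peanification -/

/-- The Peanification of `X`: the set `X` with the topology whose basis consists of the path
components of the open subsets of `X`. -/
def Peanification (X : Type u) : Type u := X

section peano
variable {X : Type u} [TopologicalSpace X]

instance : TopologicalSpace (Peanification X) where
  IsOpen V := ∀ x ∈ V, ∃ U : Set X, IsOpen U ∧ x ∈ U ∧ pathComponentIn U x ⊆ V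
  isOpen_univ := fun _ _ => ⟨univ, isOpen_univ, mem_univ _, subset_univ _⟩
  isOpen_inter := by
    rintro V V' h h' x ⟨hx, hx'⟩
    obtain ⟨U, hU, hxU, hUV⟩ := h x hx
    obtain ⟨U', hU', hxU', hUV'⟩ := h' x hx'
    exact ⟨U ∩ U', hU.inter hU', ⟨hxU, hxU'⟩,
      subset_inter ((pathComponentIn_mono inter_subset_left).trans hUV)
        ((pathComponentIn_mono inter_subset_right).trans hUV')⟩
  isOpen_sUnion := by
    rintro A h x ⟨V, hV, hx⟩
    obtain ⟨U, hU, hxU, hUV⟩ := h V hV x hx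
    exact ⟨U, hU, hxU, hUV.trans (subset_sUnion_of_mem hV)⟩

theorem isOpen_peanification {V : Set (Peanification X)} : IsOpen V ↔
    ∀ x ∈ V, ∃ U : Set X, IsOpen U ∧ (x : X) ∈ U ∧ pathComponentIn (X := X) U x ⊆ V := Iff.rfl

/-- The identity map from the Peanification of `X` to `X`. -/
def Peanification.toBase : Peanification X → X := fun x => x

theorem Peanification.continuous_toBase : Continuous (Peanification.toBase (X := X)) :=
  ⟨fun U hU _ hx => ⟨U, hU, hx, pathComponentIn_subset⟩⟩

theorem Peanification.isOpen_pathComponentIn {U : Set X} (hU : IsOpen U) (x : X) :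
    IsOpen (X := Peanification X) (pathComponentIn (X := X) U x) := by
  refine isOpen_peanification.2 fun y hy =>
    ⟨U, hU, pathComponentIn_subset (X := X) hy, ?_⟩
  exact (pathComponentIn_congr (X := X) hy).subset

/-- Maps from locally path-connected spaces to `X` are continuous as maps to the
Peanification. -/
theorem Peanification.continuous_of_continuous {Y : Type v} [TopologicalSpace Y]
    [LocallyPathConnectedSpace Y] {f : Y → X} (hf : Continuous f) :
    Continuous (Y := Peanification X) f := by
  refine continuous_def.2 fun V hV => isOpen_iff_mem_nhds.2 fun y hy => ?_
  obtain ⟨U, hU, hxU, hUV⟩ := isOpen_peanification.1 hV (f y) hy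
  have hU' : IsOpen (f ⁻¹' U) := hU.preimage hf
  refine Filter.mem_of_superset (pathComponentIn_mem_nhds (hU'.mem_nhds hxU)) fun y' hy' => ?_
  exact hUV ((JoinedIn.map hy' hf).mono (image_preimage_subset f U))

theorem Peanification.joinedIn {V : Set X} {x y : X} (h : JoinedIn V x y) :
    JoinedIn (X := Peanification X) V x y := by
  obtain ⟨γ, hγ⟩ := h
  have : LocallyPathConnectedSpace I := (convex_Icc (0 : ℝ) 1).locallyPathConnectedSpace
  exact ⟨⟨⟨fun t => γ t, Peanification.continuous_of_continuous γ.continuous⟩,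
    γ.source, γ.target⟩, hγ⟩

instance : LocallyPathConnectedSpace (Peanification X) := by
  refine locallyPathConnectedSpace_iff_pathComponentIn_mem_nhds.2 fun x V hV hx => ?_
  obtain ⟨U, hU, hxU, hUV⟩ := isOpen_peanification.1 hV x hx
  refine Filter.mem_of_superset ((Peanification.isOpen_pathComponentIn hU x).mem_nhds
    (mem_pathComponentIn_self (X := X) hxU)) fun y hy => ?_
  have h₁ : JoinedIn (X := X) (pathComponentIn (X := X) U x) x y :=
    (isPathConnected_pathComponentIn (X := X) hxU).joinedIn _
      (mem_pathComponentIn_self (X := X) hxU) _ hy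
  exact (Peanification.joinedIn h₁).mono hUV

theorem Peanification.isPeano [PathConnectedSpace X] : IsPeano (Peanification X) := by
  have : PathConnectedSpace (Peanification X) :=
    ⟨‹PathConnectedSpace X›.nonempty, fun x y => by
      have := Peanification.joinedIn (X := X) (V := univ) (x := x) (y := y)
        (joinedIn_univ.2 (PathConnectedSpace.joined _ _))
      exact this.joined⟩
  exact ⟨inferInstance, inferInstance⟩

/-- Maps from disk-hedgehogs to `X` are continuous as maps to the Peanification. -/
theorem Peanification.continuous_of_isDiskHedgehog {H : Type v} [TopologicalSpace H]
    (hH : IsDiskHedgehog H) {f : H → X} (hf : Continuous f) :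
    Continuous (Y := Peanification X) f := by
  obtain ⟨S, _, _, _, z, ⟨φ⟩⟩ := hH
  have := pathConnectedSpace_unitDisk
  have := locallyPathConnectedSpace_unitDisk
  set g : DirectedWedge (fun _ : S => UnitDisk) z → X := f ∘ φ.symm with hg
  have hgc : Continuous g := hf.comp φ.symm.continuous
  suffices h : Continuous (Y := Peanification X) g by
    have := h.comp φ.continuous
    have hfg : Function.comp (δ := Peanification X) g φ = f := by
      funext x
      exact congrArg f (φ.symm_apply_apply x)
    rwa [hfg] at this
  refine continuous_def.2 fun V hV => DirectedWedge.isOpen_iff.2 ⟨fun s => ?_, fun i hi => ?_⟩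
  · exact hV.preimage (Peanification.continuous_of_continuous
      (hgc.comp (DirectedWedge.continuous_incl s)))
  · obtain ⟨U, hU, hxU, hUV⟩ := isOpen_peanification.1 hV _ hi
    obtain ⟨t, ht⟩ := (DirectedWedge.isOpen_iff.1 (hU.preimage hgc)).2 i hxU
    refine ⟨t, fun s hs x => hUV ?_⟩
    have h₁ := (PathConnectedSpace.joined (z s) x)
    have h₂ : JoinedIn univ (z s) x := joinedIn_univ.2 h₁
    have h₃ := h₂.map (hgc.comp (DirectedWedge.continuous_incl (z := z) s))
    rw [Function.comp_apply, DirectedWedge.incl_base _ z s i] at h₃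
    refine h₃.mono ?_
    rintro _ ⟨y, -, rfl⟩
    exact ht s hs y

end peano

/-! ### Constructions of coverings -/

section constructions

/-- The Peanification of the path component of `e`. -/
def PeanoPart {E : Type v} [TopologicalSpace E] (e : E) : Type v := Peanification (pathComponent e)

instance {E : Type v} [TopologicalSpace E] (e : E) : TopologicalSpace (PeanoPart e) :=
  inferInstanceAs (TopologicalSpace (Peanification (pathComponent e)))

/-- The natural injection into `E` of the Peanification of a path component. -/
def PeanoPart.val {E : Type v} [TopologicalSpace E] {e : E} (x : PeanoPart e) : E :=
  (show pathComponent e from x).1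

/-- The point `e` as an element of the Peanification of its path component. -/
def PeanoPart.base {E : Type v} [TopologicalSpace E] (e : E) : PeanoPart e :=
  (⟨e, mem_pathComponent_self e⟩ : pathComponent e)

theorem PeanoPart.continuous_val {E : Type v} [TopologicalSpace E] {e : E} :
    Continuous (PeanoPart.val (e := e)) :=
  continuous_subtype_val.comp (Peanification.continuous_toBase (X := pathComponent e))

theorem PeanoPart.isPeano {E : Type v} [TopologicalSpace E] (e : E) : IsPeano (PeanoPart e) := by
  have : PathConnectedSpace (pathComponent e) :=
    isPathConnected_iff_pathConnectedSpace.1 isPathConnected_pathComponent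
  exact Peanification.isPeano

theorem PeanoPart.isCovering {E : Type v} {B : Type u} [TopologicalSpace E] [TopologicalSpace B]
    {p : E → B} (hp : IsDiskHedgehogCovering p) (e : E) :
    IsDiskHedgehogCovering (fun x : PeanoPart e => p x.val) := by
  refine ⟨hp.continuous.comp PeanoPart.continuous_val, ?_, ?_⟩
  · intro H _ hH f x₀ e₀ h
    obtain ⟨g, hg, hg'⟩ := hp.lifting H hH f x₀ e₀.val h
    have := hH.pathConnectedSpace
    have hmem : ∀ x, g x ∈ pathComponent e := fun x => by
      have h₁ : Joined e e₀.val := (show pathComponent e from e₀).2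
      rw [← hg'] at h₁
      exact h₁.trans ((PathConnectedSpace.joined x₀ x).map g.continuous)
    refine ⟨⟨fun x => (⟨g x, hmem x⟩ : pathComponent e), ?_⟩, hg, Subtype.ext hg'⟩
    exact Peanification.continuous_of_isDiskHedgehog hH (X := pathComponent e)
      (g.continuous.subtype_mk hmem)
  · intro H _ hH g h hgh hx
    obtain ⟨x₀, hx⟩ := hx
    have := hp.unique H hH ((⟨PeanoPart.val, PeanoPart.continuous_val⟩ : C(_, E)).comp g)
      ((⟨PeanoPart.val, PeanoPart.continuous_val⟩ : C(_, E)).comp h) hgh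
      ⟨x₀, congrArg PeanoPart.val hx⟩
    ext x
    exact Subtype.ext (congrArg (fun k : C(H, E) => k x) this)

/-- Fibered products over `B` of disk-hedgehog coverings. -/
theorem isCovering_fiberProd {ι : Type w} {E : ι → Type v} {B : Type u}
    [∀ i, TopologicalSpace (E i)] [TopologicalSpace B] {p : ∀ i, E i → B}
    (hp : ∀ i, IsDiskHedgehogCovering (p i)) :
    IsDiskHedgehogCovering
      (fun x : {y : B × (∀ i, E i) // ∀ i, p i (y.2 i) = y.1} => x.1.1) := by
  refine ⟨by fun_prop, ?_, ?_⟩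
  · intro H _ hH f x₀ e₀ h
    choose g hg hg' using fun i => (hp i).lifting H hH f x₀ (e₀.1.2 i) (h.trans (e₀.2 i).symm)
    refine ⟨⟨fun x => ⟨(f x, fun i => g i x), fun i => hg i x⟩, by fun_prop⟩, fun _ => rfl, ?_⟩
    exact Subtype.ext (Prod.ext h (funext hg'))
  · rintro H _ hH g h hgh ⟨x₀, hx⟩
    have key : ∀ i, (⟨fun x => (g x).1.2 i, by fun_prop⟩ : C(H, E i)) =
        ⟨fun x => (h x).1.2 i, by fun_prop⟩ := fun i =>
      (hp i).unique H hH _ _ (fun x => ((g x).2 i).trans ((hgh x).trans ((h x).2 i).symm))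
        ⟨x₀, by simp [hx]⟩
    refine ContinuousMap.ext fun x => ?_
    exact Subtype.ext (Prod.ext (hgh x)
      (funext fun i => congrArg (fun k : C(H, E i) => k x) (key i)))

/-- Pullbacks of disk-hedgehog coverings. -/
theorem isCovering_pullback {B₁ B₂ : Type u} {E : Type v} [TopologicalSpace B₁]
    [TopologicalSpace B₂] [TopologicalSpace E] (f : C(B₁, B₂)) {p : E → B₂}
    (hp : IsDiskHedgehogCovering p) :
    IsDiskHedgehogCovering (fun x : {y : B₁ × E // f y.1 = p y.2} => x.1.1) := by
  refine ⟨by fun_prop, ?_, ?_⟩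
  · intro H _ hH k x₀ e₀ h
    obtain ⟨g, hg, hg'⟩ := hp.lifting H hH (f.comp k) x₀ e₀.1.2
      ((congrArg f h).trans e₀.2)
    refine ⟨⟨fun x => ⟨(k x, g x), (hg x).symm⟩, by fun_prop⟩, fun _ => rfl, ?_⟩
    exact Subtype.ext (Prod.ext h hg')
  · rintro H _ hH g h hgh ⟨x₀, hx⟩
    have key := hp.unique H hH (⟨fun x => (g x).1.2, by fun_prop⟩ : C(H, E))
      ⟨fun x => (h x).1.2, by fun_prop⟩
      (fun x => (g x).2.symm.trans ((congrArg f (hgh x)).trans (h x).2)) ⟨x₀, by simp [hx]⟩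
    refine ContinuousMap.ext fun x => ?_
    exact Subtype.ext (Prod.ext (hgh x) (congrArg (fun k : C(H, E) => k x) key))

theorem IsCovering.comp_homeomorph {E : Type v} {E' : Type w} {B : Type u} [TopologicalSpace E]
    [TopologicalSpace E'] [TopologicalSpace B] {p : E → B} (hp : IsDiskHedgehogCovering p)
    (φ : E' ≃ₜ E) : IsDiskHedgehogCovering (fun x => p (φ x)) := by
  refine ⟨hp.continuous.comp φ.continuous, ?_, ?_⟩
  · intro H _ hH f x₀ e₀ h
    obtain ⟨g, hg, hg'⟩ := hp.lifting H hH f x₀ (φ e₀) h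
    exact ⟨(⟨φ.symm, φ.symm.continuous⟩ : C(E, E')).comp g, fun x => by simp [hg],
      by simp [hg']⟩
  · rintro H _ hH g h hgh ⟨x₀, hx⟩
    have := hp.unique H hH ((⟨φ, φ.continuous⟩ : C(E', E)).comp g)
      ((⟨φ, φ.continuous⟩ : C(E', E)).comp h) hgh ⟨x₀, by simp [hx]⟩
    ext x
    exact φ.injective (congrArg (fun k : C(H, E) => k x) this)

end constructions

/-! ### The maximal disk-hedgehog covering -/

/-- A disk-hedgehog covering of `B` whose total space is a Peano space. -/
structure PeanoCovering (B : Type u) [TopologicalSpace B] where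
  /-- the total space -/
  Total : Type u
  [top : TopologicalSpace Total]
  /-- the projection -/
  proj : Total → B
  isPeano : IsPeano Total
  isCovering : IsDiskHedgehogCovering proj

attribute [instance] PeanoCovering.top

/-- The inequality `(p₁, e₁) ≥ (p₂, e₂)` of pointed coverings. -/
def PointedGE {B : Type u} [TopologicalSpace B] (p₁ p₂ : PeanoCovering B) (e₁ : p₁.Total)
    (e₂ : p₂.Total) : Prop :=
  p₁.proj e₁ = p₂.proj e₂ ∧
    ∃ f : C(p₁.Total, p₂.Total), (∀ x, p₂.proj (f x) = p₁.proj x) ∧ f e₁ = e₂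

/-- The inequality `p₁ ≥ p₂` of unpointed coverings. -/
def UnpointedGE {B : Type u} [TopologicalSpace B] (p₁ p₂ : PeanoCovering B) : Prop :=
  ∀ e₁ e₂, p₁.proj e₁ = p₂.proj e₂ → PointedGE p₁ p₂ e₁ e₂

/-- `p` is the maximal disk-hedgehog covering among those with total space being Peano. -/
def PeanoCovering.IsMaximal {B : Type u} [TopologicalSpace B] (p : PeanoCovering B) : Prop :=
  ∀ q : PeanoCovering B, UnpointedGE p q

/-- Every path-connected space has a maximal disk-hedgehog covering, obtained from the Peano
fibered product of all pointed coverings. -/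
theorem exists_isMaximal (B : Type u) [TopologicalSpace B] [PathConnectedSpace B] :
    ∃ p : PeanoCovering B, p.IsMaximal := by
  obtain ⟨b₀⟩ := (inferInstance : Nonempty B)
  let ι : Type (u + 1) := Σ q : PeanoCovering B, {e : q.Total // q.proj e = b₀}
  let T : Type (u + 1) :=
    {y : B × (∀ i : ι, i.1.Total) // ∀ i : ι, i.1.proj (y.2 i) = y.1}
  have hT : IsDiskHedgehogCovering (fun x : T => x.1.1) :=
    isCovering_fiberProd (fun i : ι => i.1.isCovering)
  let e₀ : T := ⟨(b₀, fun i : ι => i.2.1), fun i : ι => i.2.2⟩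
  let P := PeanoPart e₀
  have hP : IsDiskHedgehogCovering (fun x : P => x.val.1.1) := PeanoPart.isCovering hT e₀
  have hPeano : IsPeano P := PeanoPart.isPeano e₀
  have hconn : PathConnectedSpace P := by
    have := hPeano.connected
    have := hPeano.locallyPathConnected
    exact .of_locallyPathConnectedSpace
  have harc := hP.isArcCovering
  have hsmall : Small.{u} P := by
    choose F hF using fun a : (Σ b : B, Path b₀ b) =>
      harc.exists_pathLifts a.2 (x := PeanoPart.base e₀) rfl
    refine small_of_surjective (f := F) fun e => ?_
    let γ := PathConnectedSpace.somePath (PeanoPart.base e₀) e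
    refine ⟨⟨_, γ.map hP.continuous⟩, ?_⟩
    exact harc.pathLifts_unique (hF ⟨_, γ.map hP.continuous⟩) ⟨γ, fun _ => rfl⟩
  let φ : Shrink.{u} P ≃ₜ P := (Shrink.homeomorph P).symm
  have hQ : IsDiskHedgehogCovering (fun x : Shrink.{u} P => (φ x).val.1.1) :=
    hP.comp_homeomorph φ
  refine ⟨⟨Shrink.{u} P, fun x => (φ x).val.1.1, ⟨?_, ?_⟩, hQ⟩, ?_⟩
  · have := hPeano.connected
    exact φ.symm.surjective.connectedSpace φ.symm.continuous
  · have := hPeano.locallyPathConnected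
    exact φ.isOpenEmbedding.locallyPathConnectedSpace
  · intro q e₁ e₂ h
    refine ⟨h, ?_⟩
    let γ := PathConnectedSpace.somePath (PeanoPart.base e₀) (φ e₁)
    obtain ⟨e', he'⟩ := q.isCovering.isArcCovering.exists_pathLifts
      (γ.map hP.continuous).symm (x := e₂) h.symm
    let i : ι := ⟨q, e', he'.target⟩
    have hc : Continuous fun x : Shrink.{u} P => (φ x).val.1.2 i := by
      have h₁ : Continuous fun y : T => y.1.2 i := by fun_prop
      exact h₁.comp (PeanoPart.continuous_val.comp φ.continuous)
    refine ⟨⟨_, hc⟩, fun x => (φ x).val.2 i, ?_⟩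
    refine q.isCovering.isArcCovering.pathLifts_unique (α := γ.map hP.continuous) (x := e') ?_ ?_
    · have hc' : Continuous fun x : P => x.val.1.2 i := by
        have h₁ : Continuous fun y : T => y.1.2 i := by fun_prop
        exact h₁.comp PeanoPart.continuous_val
      exact ⟨γ.map hc', fun t => (γ t).val.2 i⟩
    · exact pathLifts_symm_iff.1 he'

/-- The maximal disk-hedgehog covering over `B`. -/
noncomputable def maximalCovering (B : Type u) [TopologicalSpace B] [PathConnectedSpace B] :
    PeanoCovering B := (exists_isMaximal B).choose

theorem maximalCovering_isMaximal (B : Type u) [TopologicalSpace B] [PathConnectedSpace B] :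
    (maximalCovering B).IsMaximal := (exists_isMaximal B).choose_spec

theorem PeanoCovering.isArcCovering {B : Type u} [TopologicalSpace B] (p : PeanoCovering B) :
    IsArcCovering p.proj := p.isCovering.isArcCovering

/-! ### The hedgehog fundamental group -/

/-- The hedgehog fundamental group `π(B, b₀)`: the monodromy group at `b₀` of the maximal
disk-hedgehog covering over `B`. -/
abbrev HedgehogFundamentalGroup (B : Type u) [TopologicalSpace B] [PathConnectedSpace B] (b₀ : B) :
    Type u :=
  MonodromyGroup (maximalCovering B).isArcCovering b₀

/-- If two loops are equivalent for the maximal covering, so are their images under a map. -/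
theorem monodromyRel_map {B₁ B₂ : Type u} [TopologicalSpace B₁] [PathConnectedSpace B₁]
    [TopologicalSpace B₂] [PathConnectedSpace B₂] (f : C(B₁, B₂)) {b₁ : B₁} {α β : Path b₁ b₁}
    (h : MonodromyRel (maximalCovering B₁).proj α β) :
    MonodromyRel (maximalCovering B₂).proj (α.map f.continuous) (β.map f.continuous) := by
  set p₁ := maximalCovering B₁
  set p₂ := maximalCovering B₂
  refine (monodromyRel_iff _ _ _).2 fun x y y' hy hy' => ?_
  have hx : f b₁ = p₂.proj x := hy.source.symm
  let w : {y : B₁ × p₂.Total // f y.1 = p₂.proj y.2} := ⟨(b₁, x), hx⟩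
  let q : PeanoCovering B₁ := ⟨PeanoPart w, fun z => z.val.1.1, PeanoPart.isPeano w,
    PeanoPart.isCovering (isCovering_pullback f p₂.isCovering) w⟩
  have : Nonempty p₁.Total := p₁.isPeano.connected.toNonempty
  obtain ⟨e₁, he₁⟩ := p₁.isArcCovering.surjective b₁
  obtain ⟨-, F, hF, hFe⟩ := maximalCovering_isMaximal B₁ q e₁ (PeanoPart.base w) he₁
  have hval : Continuous fun z : p₁.Total => ((F z).val.1.2 : p₂.Total) := by
    have h₁ : Continuous fun y : {y : B₁ × p₂.Total // f y.1 = p₂.proj y.2} => y.1.2 := by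
      fun_prop
    exact h₁.comp (PeanoPart.continuous_val.comp F.continuous)
  have key : ∀ (γ : Path b₁ b₁) (e : p₁.Total), PathLifts p₁.proj γ e₁ e →
      PathLifts p₂.proj (γ.map f.continuous) x ((F e).val.1.2) := by
    rintro γ e ⟨a, ha⟩
    refine ⟨(a.map hval).cast (by rw [hFe]; rfl) rfl, fun t => ?_⟩
    have h₁ := (F (a t)).val.2
    have h₂ : (F (a t)).val.1.1 = p₁.proj (a t) := hF (a t)
    rw [h₂, ha t] at h₁
    exact h₁.symm
  obtain ⟨e, he⟩ := p₁.isArcCovering.exists_pathLifts α he₁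
  have he' := ((p₁.isArcCovering.monodromyRel_iff _ _).1 h e₁ e).1 he
  exact (p₂.isArcCovering.pathLifts_unique hy (key α e he)).trans
    (p₂.isArcCovering.pathLifts_unique (key β e he') hy')

/-- The homomorphism `π(B₁, b₁) → π(B₂, f b₁)` induced by a map `f`; it sends the class of a loop
`α` to the class of `f ∘ α`. -/
noncomputable def HedgehogFundamentalGroup.map {B₁ B₂ : Type u} [TopologicalSpace B₁]
    [PathConnectedSpace B₁] [TopologicalSpace B₂] [PathConnectedSpace B₂] (f : C(B₁, B₂)) (b₁ : B₁) :
    HedgehogFundamentalGroup B₁ b₁ →* HedgehogFundamentalGroup B₂ (f b₁) :=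
  MonoidHom.mk' (Quotient.map (fun α => α.map f.continuous) fun _ _ h => monodromyRel_map f h) (by
    rintro ⟨α⟩ ⟨β⟩
    exact congrArg (MonodromyGroup.mk _) (Path.map_trans α β f.continuous))

/-! ### Stars, nerves and their geometric realizations -/

/-- The star of the family `𝒰` at `x`: the union of the members of `𝒰` that contain `x`. -/
def star {B : Type u} (x : B) (𝒰 : Set (Set B)) : Set B := ⋃₀ {V | V ∈ 𝒰 ∧ x ∈ V}

theorem mem_star {B : Type u} {𝒰 : Set (Set B)} (hcov : ⋃₀ 𝒰 = univ) (x : B) : x ∈ star x 𝒰 := by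
  obtain ⟨V, hV, hx⟩ := (hcov.symm ▸ mem_univ x : x ∈ ⋃₀ 𝒰)
  exact ⟨V, ⟨hV, hx⟩, hx⟩

theorem pathConnectedSpace_star {B : Type u} [TopologicalSpace B] {𝒰 : Set (Set B)}
    (hcov : ⋃₀ 𝒰 = univ) (hpc : ∀ V ∈ 𝒰, IsPathConnected V) (x : B) :
    PathConnectedSpace (star x 𝒰) := by
  refine isPathConnected_iff_pathConnectedSpace.1 ⟨x, mem_star hcov x, ?_⟩
  rintro y ⟨V, ⟨hV, hx⟩, hy⟩
  exact ((hpc V hV).joinedIn x hx y hy).mono (fun w hw => ⟨V, ⟨hV, hx⟩, hw⟩)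

/-- The nerve of `𝒰`: the vertices are the members of `𝒰`, and finitely many members (at least one)
span a simplex if they have a common point. -/
def nerve {B : Type u} (𝒰 : Set (Set B)) : PreAbstractSimplicialComplex 𝒰 where
  faces := {s | s.Nonempty ∧ ∃ x : B, ∀ V ∈ s, x ∈ V.1}
  isRelLowerSet_faces := fun _ ⟨hne, x, hx⟩ =>
    ⟨hne, fun _ hts ht => ⟨ht, x, fun V hV => hx V (hts hV)⟩⟩

section realization
variable {ι : Type u}

/-- The closed simplex spanned by the finite set `s`, in barycentric coordinates, with the
Euclidean topology. -/
def closedSimplex (s : Finset ι) : Set (ι → ℝ) :=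
  {t | (∀ i, 0 ≤ t i) ∧ (∀ i ∉ s, t i = 0) ∧ ∑ i ∈ s, t i = 1}

/-- The geometric realization of a simplicial complex, as the set of barycentric coordinates of the
points of its simplices. -/
def GeometricRealization (K : PreAbstractSimplicialComplex ι) : Type u :=
  {t : ι → ℝ // ∃ s ∈ K.faces, t ∈ closedSimplex s}

/-- The inclusion of a closed simplex into the geometric realization. -/
def GeometricRealization.incl (K : PreAbstractSimplicialComplex ι) (s : K.faces)
    (t : closedSimplex s.1) : GeometricRealization K :=
  ⟨t.1, s.1, s.2, t.2⟩

/-- The weak (coherent) topology: a set is open if and only if its intersection with every closed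
simplex is open in that simplex. -/
instance (K : PreAbstractSimplicialComplex ι) : TopologicalSpace (GeometricRealization K) :=
  ⨆ s : K.faces, TopologicalSpace.coinduced (GeometricRealization.incl K s) inferInstance

end realization

end Hedgehog

/-! Both groups solve the same universal problem, which sees only which triples of members of the
cover have a common point (the relation `Meet`). A cocycle assigns group elements to pairs of
indices so that `c i j * c j k = c i k` on meeting triples. It is universal if the values of closed
edge chains exhaust its group and determine the values of every other cocycle. The group of a
universal cocycle is unique up to isomorphism (`IsUniversalCocycle.nonempty_mulEquiv`). The open
stars of the vertices of the nerve meet exactly as the members of the cover do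
(`meet_openStar_nerve`). It therefore suffices to find universal cocycles with values in `π(B, b₀)`
for the cover, and in the fundamental group of the nerve for the open stars.

Both come from `IsPathClassMap.exists_isUniversalCocycle`, whose input is a multiplicative
assignment of group elements to paths. Parallel paths inside members of the cover get equal values,
so the assignment produces a cocycle, and subdividing paths shows that its chain values exhaust the
group. Universality uses covering spaces: a competing cocycle `c` is the transition data of a
principal covering (`IsCocycle.exists_isCoveringMap`) whose monodromy along a chain is the value of
`c`. This monodromy depends only on the class of the path.

For `π(B, b₀)`, classical covering maps are disk-hedgehog coverings, so by maximality the maximal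
covering determines their monodromy. The hypothesis on stars makes parallel paths in members of the
cover equivalent. For the nerve, the monodromy theorem for homotopic paths plays the first role;
contractibility of open stars and path-connectedness of their pairwise intersections play the
second. -/

namespace Hedgehog

/-! ### Subdivision of paths -/

section subdivision
variable {X : Type u} [TopologicalSpace X]

/-- The first half of the unit interval, reparametrized. -/
noncomputable def firstHalf (t : I) : I :=
  ⟨(t : ℝ) / 2, by have := t.2.1; positivity, by have := t.2.2; linarith⟩

/-- The second half of the unit interval, reparametrized. -/
noncomputable def secondHalf (t : I) : I :=
  ⟨((t : ℝ) + 1) / 2, by have := t.2.1; positivity, by have := t.2.2; linarith⟩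

/-- Every path is the concatenation of its two halves. -/
theorem exists_eq_trans_halves {a b : X} (α : Path a b) :
    ∃ (c : X) (β : Path a c) (γ : Path c b), α = β.trans γ ∧
      (∀ t, β t = α (firstHalf t)) ∧ ∀ t, γ t = α (secondHalf t) := by
  have hf : Continuous firstHalf := by unfold firstHalf; fun_prop
  have hs : Continuous secondHalf := by unfold secondHalf; fun_prop
  have h0 : firstHalf 0 = 0 := Subtype.ext (by simp [firstHalf])
  have h1 : secondHalf 1 = 1 := Subtype.ext (by norm_num [secondHalf])
  have h01 : secondHalf 0 = firstHalf 1 := Subtype.ext (by simp [firstHalf, secondHalf])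
  refine ⟨α (firstHalf 1), ⟨⟨fun t => α (firstHalf t), by fun_prop⟩, by simp [h0], rfl⟩,
    ⟨⟨fun t => α (secondHalf t), by fun_prop⟩, by simp [h01], by simp [h1]⟩, ?_,
    fun _ => rfl, fun _ => rfl⟩
  ext t
  rw [Path.trans_apply]
  split_ifs with h
  · exact congrArg α (Subtype.ext (by simp [firstHalf]))
  · exact congrArg α (Subtype.ext (by simp [secondHalf]))

/-- A property of paths that holds for the paths inside a member of an open cover and is stable
under concatenation holds for all paths. -/
theorem path_induction {ι : Type v} {U : ι → Set X} (hU : ∀ i, IsOpen (U i))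
    (hcov : ∀ x, ∃ i, x ∈ U i) {P : ∀ {a b : X}, Path a b → Prop}
    (hloc : ∀ (i : ι) {a b : X} (α : Path a b), (∀ t, α t ∈ U i) → P α)
    (htrans : ∀ {a b c : X} (α : Path a b) (β : Path b c), P α → P β → P (α.trans β))
    {a b : X} (α : Path a b) : P α := by
  -- Halving a path doubles the parameter scale on which it stays in one member of the cover, whence
  -- induction on `n`. At `n = 0` the ball of radius `1` about `0` is the whole interval.
  have key : ∀ (n : ℕ) {a b : X} (α : Path a b),
      (∀ s : I, ∃ i, ∀ t : I, dist s t ≤ (1 / 2) ^ n → α t ∈ U i) → P α := by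
    intro n
    induction n with
    | zero =>
      intro a b α h
      obtain ⟨i, hi⟩ := h 0
      refine hloc i α fun t => hi t ?_
      rw [Subtype.dist_eq, Real.dist_eq, abs_le]
      have := t.2.1
      have := t.2.2
      constructor <;> simp <;> linarith
    | succ n ih =>
      intro a b α h
      obtain ⟨c, β, γ, rfl, hβ, hγ⟩ := exists_eq_trans_halves α
      refine htrans β γ (ih β fun s => ?_) (ih γ fun s => ?_)
      · obtain ⟨i, hi⟩ := h (firstHalf s)
        refine ⟨i, fun t ht => hβ t ▸ hi _ ?_⟩
        rw [Subtype.dist_eq, Real.dist_eq] at ht ⊢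
        rw [abs_le] at ht ⊢
        rw [pow_succ]
        constructor <;> simp only [firstHalf] <;> linarith
      · obtain ⟨i, hi⟩ := h (secondHalf s)
        refine ⟨i, fun t ht => hγ t ▸ hi _ ?_⟩
        rw [Subtype.dist_eq, Real.dist_eq] at ht ⊢
        rw [abs_le] at ht ⊢
        rw [pow_succ]
        constructor <;> simp only [secondHalf] <;> linarith
  -- The starting scale is a power of `1 / 2` below a Lebesgue number of the pulled-back cover.
  obtain ⟨δ, hδ, h⟩ := lebesgue_number_lemma_of_metric (s := (univ : Set I)) (c := fun i => α ⁻¹' U i)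
    isCompact_univ (fun i => (hU i).preimage α.continuous)
    (fun t _ => mem_iUnion.2 (hcov (α t)))
  obtain ⟨n, hn⟩ := exists_pow_lt_of_lt_one hδ (by norm_num : (1 / 2 : ℝ) < 1)
  refine key n α fun s => ?_
  obtain ⟨i, hi⟩ := h s (mem_univ s)
  exact ⟨i, fun t ht => hi (by rw [Metric.mem_ball, dist_comm]; exact ht.trans_lt hn)⟩

theorem exists_path_of_mem {V : Set X} (hV : IsPathConnected V) {a b : X} (ha : a ∈ V)
    (hb : b ∈ V) : ∃ α : Path a b, ∀ t, α t ∈ V :=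
  hV.joinedIn a ha b hb

theorem path_trans_mem {V : Set X} {a b c : X} {α : Path a b} {β : Path b c}
    (hα : ∀ t, α t ∈ V) (hβ : ∀ t, β t ∈ V) (t : I) : α.trans β t ∈ V := by
  rw [Path.trans_apply]
  split_ifs
  · exact hα _
  · exact hβ _

end subdivision

/-! ### Cocycles and chains -/

section cocycle
variable {ι : Type u}

/-- A cocycle on the ternary relation `T` with values in a group. -/
def IsCocycle (T : ι → ι → ι → Prop) {H : Type u} [Group H] (c : ι → ι → H) : Prop :=
  ∀ i j k, T i j k → c i j * c j k = c i k

theorem IsCocycle.self {T : ι → ι → ι → Prop} {H : Type u} [Group H] {c : ι → ι → H}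
    (hc : IsCocycle T c) {i : ι} (h : T i i i) : c i i = 1 := by
  simpa using hc i i i h

/-- Edge chains: sequences of indices in which consecutive indices are related. -/
inductive EdgeChain (T : ι → ι → ι → Prop) : ι → ι → Type u
  | nil (i : ι) : EdgeChain T i i
  | cons {i j k : ι} (h : T i j j) (l : EdgeChain T j k) : EdgeChain T i k

/-- The product of the values of `c` on the edges of a chain. -/
def EdgeChain.value {T : ι → ι → ι → Prop} {H : Type u} [Group H] (c : ι → ι → H) :
    ∀ {i j : ι}, EdgeChain T i j → H
  | _, _, .nil _ => 1
  | i, _, .cons (j := j) _ l => c i j * l.value c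

/-- The concatenation of edge chains. -/
def EdgeChain.append {T : ι → ι → ι → Prop} :
    ∀ {i j k : ι}, EdgeChain T i j → EdgeChain T j k → EdgeChain T i k
  | _, _, _, .nil _, m => m
  | _, _, _, .cons h l, m => .cons h (l.append m)

theorem EdgeChain.value_append {T : ι → ι → ι → Prop} {H : Type u} [Group H] (c : ι → ι → H)
    {i j k : ι} (l : EdgeChain T i j) (m : EdgeChain T j k) :
    (l.append m).value c = l.value c * m.value c := by
  induction l with
  | nil i => simp [append, value]
  | cons h l ih => simp [append, value, ih, mul_assoc]

/-- A cocycle is universal at `i` if the chains from `i` to `i` represent all elements of the group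
and their values determine the values of every other cocycle. -/
structure IsUniversalCocycle (T : ι → ι → ι → Prop) {G : Type u} [Group G] (g : ι → ι → G)
    (i : ι) : Prop where
  isCocycle : IsCocycle T g
  exists_value : ∀ h : G, ∃ l : EdgeChain T i i, l.value g = h
  value_eq : ∀ {H : Type u} [Group H] (c : ι → ι → H), IsCocycle T c →
    ∀ l m : EdgeChain T i i, l.value g = m.value g → l.value c = m.value c

/-- The groups of two universal cocycles are isomorphic. -/
theorem IsUniversalCocycle.nonempty_mulEquiv {T : ι → ι → ι → Prop} {G G' : Type u} [Group G]
    [Group G'] {g : ι → ι → G} {g' : ι → ι → G'} {i : ι} (hg : IsUniversalCocycle T g i)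
    (hg' : IsUniversalCocycle T g' i) : Nonempty (G ≃* G') := by
  choose l hl using hg.exists_value
  choose m hm using hg'.exists_value
  -- An element is represented by a chain for one cocycle, and the chain is evaluated by the other.
  -- Universality makes the result independent of the chosen chain, which gives the inverse laws and
  -- multiplicativity.
  refine ⟨{ toFun := fun h => (l h).value g', invFun := fun h => (m h).value g, left_inv := ?_,
            right_inv := ?_, map_mul' := ?_ }⟩
  · intro h
    exact (hg'.value_eq g hg.isCocycle _ (l h) (hm _)).trans (hl h)
  · intro h
    exact (hg.value_eq g' hg'.isCocycle _ (m h) (hl _)).trans (hm h)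
  · intro h k
    rw [← EdgeChain.value_append]
    refine hg.value_eq g' hg'.isCocycle _ _ ?_
    rw [EdgeChain.value_append, hl, hl, hl]

/-- The relation satisfied by the triples of indices whose members of the family meet. -/
def Meet {X : Type v} (U : ι → Set X) (i j k : ι) : Prop := ∃ x, x ∈ U i ∧ x ∈ U j ∧ x ∈ U k

end cocycle

/-! ### The covering map of a cocycle -/

section bundle
variable {X : Type u} [TopologicalSpace X] {ι : Type u} {U : ι → Set X} {H : Type u} [Group H]
  {c : ι → ι → H}

/-- The principal bundle with discrete fibre defined by a cocycle on an open cover. -/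
noncomputable def cocycleBundle [TopologicalSpace H] [DiscreteTopology H]
    (hU : ∀ i, IsOpen (U i)) (hcov : ∀ x, ∃ i, x ∈ U i) (hc : IsCocycle (Meet U) c) :
    FiberBundleCore ι X H where
  baseSet := U
  isOpen_baseSet := hU
  indexAt x := (hcov x).choose
  mem_baseSet_at x := (hcov x).choose_spec
  coordChange i j _ h := h * c i j
  coordChange_self i x hx h := by rw [hc.self ⟨x, hx, hx, hx⟩, mul_one]
  continuousOn_coordChange i j :=
    ((continuous_of_discreteTopology (f := fun h : H => h * c i j)).comp
      continuous_snd).continuousOn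
  coordChange_comp i j k x hx h := by
    rw [mul_assoc, hc i j k ⟨x, hx.1.1, hx.1.2, hx.2⟩]

/-- The covering defined by a cocycle: the points over `U i` are described by pairs `(a, h)`, with
transition functions given by the cocycle, and over `U i` the coordinate `h` is constant along lifts
of paths. -/
theorem IsCocycle.exists_isCoveringMap (hU : ∀ i, IsOpen (U i)) (hcov : ∀ x, ∃ i, x ∈ U i)
    (hc : IsCocycle (Meet U) c) :
    ∃ (E : Type u) (_ : TopologicalSpace E) (p : E → X) (pt : ι → X → H → E), IsCoveringMap p ∧
      (∀ i a, a ∈ U i → Function.Injective (pt i a)) ∧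
      (∀ i j a h, a ∈ U i → a ∈ U j → pt i a h = pt j a (h * c i j)) ∧
      ∀ i {a b : X} (α : Path a b) h, (∀ t, α t ∈ U i) → PathLifts p α (pt i a h) (pt i b h) := by
  let _ : TopologicalSpace H := ⊥
  have : DiscreteTopology H := ⟨rfl⟩
  let Z := cocycleBundle hU hcov hc
  -- The total space records fibre coordinates in the preferred chart `Z.indexAt a`, so a coordinate
  -- `h` in chart `i` is first transported there.
  refine ⟨Z.TotalSpace, inferInstance, Z.proj, fun i a h => ⟨a, h * c i (Z.indexAt a)⟩,
    FiberBundle.isCoveringMap, ?_, ?_, ?_⟩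
  · intro i a ha h h' e
    injection e with _ h₁
    exact mul_right_cancel h₁
  · intro i j a h ha ha'
    have h₁ := hc i j (Z.indexAt a) ⟨a, ha, ha', Z.mem_baseSet_at a⟩
    simp only [mul_assoc, h₁]
  · intro i a b α h hα
    -- The lift is the horizontal path `(α t, h)` read in the chart over `U i`.
    have hcont : Continuous fun t => (Z.localTriv i).toOpenPartialHomeomorph.symm (α t, h) := by
      refine (Z.localTriv i).toOpenPartialHomeomorph.continuousOn_symm.comp_continuous
        (by fun_prop) fun t => ?_
      rw [Z.mem_localTriv_target]
      exact hα t
    refine ⟨⟨⟨_, hcont⟩, ?_, ?_⟩, fun t => ?_⟩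
    · simp only [FiberBundleCore.localTriv_symm_apply, α.source]; rfl
    · simp only [FiberBundleCore.localTriv_symm_apply, α.target]; rfl
    · change Z.proj ((Z.localTriv i).toOpenPartialHomeomorph.symm (α t, h)) = α t
      rw [FiberBundleCore.localTriv_symm_apply]

end bundle

/-! ### Groups of path classes adapted to an open cover -/

section pathClass
variable {X : Type u} [TopologicalSpace X] {ι : Type u} {U : ι → Set X} {G : Type u} [Group G]

/-- A multiplicative assignment of group elements to paths that is surjective on loops, does not
distinguish parallel paths lying in members of the cover, and determines the monodromy of covering
maps. -/
structure IsPathClassMap (U : ι → Set X) (ρ : ∀ {a b : X}, Path a b → G) : Prop where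
  map_trans : ∀ {a b c : X} (α : Path a b) (β : Path b c), ρ (α.trans β) = ρ α * ρ β
  exists_eq : ∀ (a : X) (g : G), ∃ α : Path a a, ρ α = g
  eq_of_mem : ∀ i j {a b : X} (α β : Path a b), (∀ t, α t ∈ U i) → (∀ t, β t ∈ U j) → ρ α = ρ β
  lifts_eq : ∀ {E : Type u} [TopologicalSpace E] (p : E → X), IsCoveringMap p →
    ∀ {a : X} (α β : Path a a), ρ α = ρ β → ∀ x y z : E, PathLifts p α x y → PathLifts p β x z →
      y = z

/-- On each `U i` the assignment is a coboundary of a potential `θ i`, and the cocycle `g` compares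
the potentials on overlaps. Chains and paths then translate into each other, up to the values of the
potentials at the end points. -/
theorem IsPathClassMap.exists_isUniversalCocycle {ρ : ∀ {a b : X}, Path a b → G}
    (hρ : IsPathClassMap U ρ) (hU : ∀ i, IsOpen (U i)) (hcov : ∀ x, ∃ i, x ∈ U i)
    (hpc : ∀ i, IsPathConnected (U i)) :
    ∃ g : ι → ι → G, ∀ i, IsUniversalCocycle (Meet U) g i := by
  have hex : ∀ i, ∃ θ : X → G, ∀ {a b : X} (α : Path a b), (∀ t, α t ∈ U i) →
      ρ α = (θ a)⁻¹ * θ b := by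
    intro i
    obtain ⟨x, hx⟩ := (hpc i).nonempty
    choose δ hδ using fun a (ha : a ∈ U i) => exists_path_of_mem (hpc i) hx ha
    classical
    refine ⟨fun a => if ha : a ∈ U i then ρ (δ a ha) else 1, fun {a b} α hα => ?_⟩
    have ha : a ∈ U i := by simpa using hα 0
    have hb : b ∈ U i := by simpa using hα 1
    simp only [dif_pos ha, dif_pos hb]
    rw [eq_inv_mul_iff_mul_eq, ← hρ.map_trans]
    exact hρ.eq_of_mem i i _ _ (path_trans_mem (hδ a ha) hα) (hδ b hb)
  choose θ hθ using hex
  -- The intersection of `U i` and `U j` may be disconnected. Two of its points are joined once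
  -- inside `U i` and once inside `U j`, and `eq_of_mem` for different indices identifies the two
  -- classes.
  have hind : ∀ i j x y, x ∈ U i → x ∈ U j → y ∈ U i → y ∈ U j →
      θ i x * (θ j x)⁻¹ = θ i y * (θ j y)⁻¹ := by
    intro i j x y hxi hxj hyi hyj
    obtain ⟨α, hα⟩ := exists_path_of_mem (hpc i) hxi hyi
    obtain ⟨β, hβ⟩ := exists_path_of_mem (hpc j) hxj hyj
    have h := hρ.eq_of_mem i j α β hα hβ
    rw [hθ i α hα, hθ j β hβ, inv_mul_eq_iff_eq_mul] at h
    rw [h]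
    group
  classical
  -- The default `1` on disjoint pairs is never evaluated, as every edge of a chain joins meeting
  -- members.
  let g : ι → ι → G := fun i j =>
    if h : ∃ x, x ∈ U i ∧ x ∈ U j then θ i h.choose * (θ j h.choose)⁻¹ else 1
  have hg : ∀ i j x, x ∈ U i → x ∈ U j → g i j = θ i x * (θ j x)⁻¹ := by
    intro i j x hi hj
    have h : ∃ x, x ∈ U i ∧ x ∈ U j := ⟨x, hi, hj⟩
    simp only [g, dif_pos h]
    exact hind i j _ _ h.choose_spec.1 h.choose_spec.2 hi hj
  have hcoc : IsCocycle (Meet U) g := by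
    rintro i j k ⟨x, hi, hj, hk⟩
    rw [hg i j x hi hj, hg j k x hj hk, hg i k x hi hk]
    group
  -- A piece inside `U k` gives the chain `i, k, j`, whose value telescopes; concatenation at `b`
  -- cancels the potential there.
  have hchain : ∀ {a b : X} (α : Path a b) i j, a ∈ U i → b ∈ U j →
      ∃ l : EdgeChain (Meet U) i j, l.value g = θ i a * ρ α * (θ j b)⁻¹ := by
    intro a b α
    refine path_induction hU hcov (P := fun {a b} α => ∀ i j, a ∈ U i → b ∈ U j →
      ∃ l : EdgeChain (Meet U) i j, l.value g = θ i a * ρ α * (θ j b)⁻¹) ?_ ?_ α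
    · intro k a b α hα i j ha hb
      have hak : a ∈ U k := by simpa using hα 0
      have hbk : b ∈ U k := by simpa using hα 1
      refine ⟨.cons ⟨a, ha, hak, hak⟩ (.cons ⟨b, hbk, hb, hb⟩ (.nil j)), ?_⟩
      simp only [EdgeChain.value]
      rw [hg i k a ha hak, hg k j b hbk hb, hθ k α hα]
      group
    · intro a b d α β hα hβ i j ha hd
      obtain ⟨k, hk⟩ := hcov b
      obtain ⟨l, hl⟩ := hα i k ha hk
      obtain ⟨m, hm⟩ := hβ k j hk hd
      refine ⟨l.append m, ?_⟩
      rw [EdgeChain.value_append, hl, hm, hρ.map_trans]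
      group
  refine ⟨g, fun i => ⟨hcoc, ?_, ?_⟩⟩
  · intro h
    obtain ⟨a, ha⟩ := (hpc i).nonempty
    -- The conjugation by `θ i a` compensates the potentials at the two ends in `hchain`.
    obtain ⟨α, hα⟩ := hρ.exists_eq a ((θ i a)⁻¹ * h * θ i a)
    obtain ⟨l, hl⟩ := hchain α i i ha ha
    refine ⟨l, hl.trans ?_⟩
    rw [hα]
    group
  · intro H _ c hc l m hlm
    obtain ⟨E, _, p, pt, hp, hinj, htr, hlift⟩ := hc.exists_isCoveringMap hU hcov
    -- One path realizes a chain for both cocycles: its class reads off the value of `g`, and its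
    -- lifts to the covering of `c` read off the value of `c`. Each edge is crossed at a common
    -- point of its two members, where the chart changes.
    have hpath : ∀ {i j : ι} (l : EdgeChain (Meet U) i j) (a b : X), a ∈ U i → b ∈ U j →
        ∃ α : Path a b, ρ α = (θ i a)⁻¹ * l.value g * θ j b ∧
          ∀ h, PathLifts p α (pt i a h) (pt j b (h * l.value c)) := by
      intro i j l
      induction l with
      | nil i =>
        intro a b ha hb
        obtain ⟨α, hα⟩ := exists_path_of_mem (hpc i) ha hb
        refine ⟨α, by simp [hθ i α hα, EdgeChain.value], fun h => ?_⟩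
        simpa [EdgeChain.value] using hlift i α h hα
      | @cons i j k hij l ih =>
        intro a b ha hb
        obtain ⟨y, hi, hj, -⟩ := hij
        obtain ⟨α, hα⟩ := exists_path_of_mem (hpc i) ha hi
        obtain ⟨β, hβ, hβ'⟩ := ih y b hj hb
        refine ⟨α.trans β, ?_, fun h => ?_⟩
        · rw [hρ.map_trans, hθ i α hα, hβ]
          simp only [EdgeChain.value]
          rw [hg i j y hi hj]
          group
        · have h₁ := hlift i α h hα
          rw [htr i j y h hi hj] at h₁
          have h₂ := h₁.trans (hβ' (h * c i j))
          simpa only [EdgeChain.value, mul_assoc] using h₂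
    obtain ⟨a, ha⟩ := (hpc i).nonempty
    obtain ⟨α, hα, hα'⟩ := hpath l a a ha ha
    obtain ⟨β, hβ, hβ'⟩ := hpath m a a ha ha
    -- Both loops are lifted from the point with coordinate `1`; their end points have the two
    -- values of `c` as coordinates.
    have := hρ.lifts_eq p hp α β (by rw [hα, hβ, hlm]) _ _ _ (hα' 1) (hβ' 1)
    simpa using hinj i a ha this

end pathClass

end Hedgehog

namespace Hedgehog

/-! ### Covering maps are disk-hedgehog coverings -/

section coveringMap

theorem simplyConnectedSpace_unitDisk : SimplyConnectedSpace UnitDisk := by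
  have := (convex_closedBall (0 : EuclideanSpace ℝ (Fin 2)) 1).contractibleSpace ⟨0, by simp⟩
  infer_instance

variable {E : Type v} {B : Type u} [TopologicalSpace E] [TopologicalSpace B] {p : E → B}

/-- Lifts to a covering space of a map on a directed wedge of disks. -/
theorem exists_lift_directedWedge (hp : IsCoveringMap p) {S : Type w} [Preorder S]
    [IsDirectedOrder S] [Nonempty S] {z : S → UnitDisk}
    (f : C(DirectedWedge (fun _ : S => UnitDisk) z, B)) (x₀ : DirectedWedge (fun _ : S => UnitDisk) z)
    (e₀ : E) (h : f x₀ = p e₀) :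
    ∃ g : C(DirectedWedge (fun _ : S => UnitDisk) z, E), (∀ x, p (g x) = f x) ∧ g x₀ = e₀ := by
  have := simplyConnectedSpace_unitDisk
  have := locallyPathConnectedSpace_unitDisk
  let j : ∀ s : S, C(UnitDisk, DirectedWedge (fun _ : S => UnitDisk) z) :=
    fun s => ⟨DirectedWedge.incl _ z s, DirectedWedge.continuous_incl s⟩
  have hj : ∀ s s', j s (z s) = j s' (z s') := DirectedWedge.incl_base _ z
  obtain ⟨s₀, y₀, rfl⟩ := DirectedWedge.exists_incl x₀
  -- The lift on the disk through `x₀` fixes the value at the wedge point, from which all other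
  -- disks are lifted.
  obtain ⟨G₀, ⟨hG₀, hG₀'⟩, -⟩ := hp.existsUnique_continuousMap_lifts (f.comp (j s₀)) y₀ e₀ h.symm
  have hG : ∀ x, p (G₀ x) = f (j s₀ x) := fun x => congrFun hG₀' x
  have hbase : ∀ s, p (G₀ (z s₀)) = f.comp (j s) (z s) := fun s => by
    rw [hG, ContinuousMap.comp_apply, hj s s₀]
  choose g hg _ using fun s => hp.existsUnique_continuousMap_lifts (f.comp (j s)) (z s)
    (G₀ (z s₀)) (hbase s)
  have hg' : ∀ s x, p (g s x) = f (j s x) := fun s x => congrFun (hg s).2 x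
  have hg₀ : (g s₀ : UnitDisk → E) = G₀ :=
    hp.eq_of_comp_eq (g s₀).continuous G₀.continuous ((hg s₀).2.trans hG₀'.symm) (z s₀) (hg s₀).1
  let F : DirectedWedge (fun _ : S => UnitDisk) z → E := Quotient.lift (fun a => g a.1 a.2) (by
    rintro ⟨s, a⟩ ⟨t, b⟩ (h | ⟨h, h'⟩)
    · rw [h]
    · dsimp only at h h' ⊢
      rw [h, h', (hg s).1, (hg t).1])
  have hF : ∀ s x, F (j s x) = g s x := fun _ _ => rfl
  refine ⟨⟨F, ?_⟩, fun x => ?_, ?_⟩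
  · refine ⟨fun V hV => DirectedWedge.isOpen_iff.2 ⟨fun s => hV.preimage (g s).continuous,
      fun i hi => ?_⟩⟩
    have hi' : G₀ (z s₀) ∈ V := by
      rw [← (hg i).1]
      exact hi
    -- Continuity at the wedge point: `f` carries all disks with large index into the part of the
    -- target of `e` that `e.symm` sends into `V`. On them uniqueness identifies the lift with
    -- `e.symm ∘ f`.
    obtain ⟨e, he, rfl⟩ := hp.isLocalHomeomorph (G₀ (z s₀))
    have hopen : IsOpen (e.target ∩ e.symm ⁻¹' V) := e.isOpen_inter_preimage_symm hV
    have hmem : f (j i (z i)) ∈ e.target ∩ e.symm ⁻¹' V := by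
      rw [← hg' i, (hg i).1]
      exact ⟨e.map_source he, by rwa [mem_preimage, e.left_inv he]⟩
    obtain ⟨t, ht⟩ := (DirectedWedge.isOpen_iff.1 (hopen.preimage f.continuous)).2 i hmem
    refine ⟨t, fun s hs x => ?_⟩
    have hcont : Continuous fun y => e.symm (f (j s y)) :=
      e.continuousOn_symm.comp_continuous (f.comp (j s)).continuous fun y => (ht s hs y).1
    have heq : (g s : UnitDisk → E) = fun y => e.symm (f (j s y)) := by
      refine hp.eq_of_comp_eq (g s).continuous hcont (funext fun y => ?_) (z s) ?_
      · exact (hg' s y).trans (e.right_inv (ht s hs y).1).symm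
      · rw [← hg' s, (hg s).1, e.left_inv he]
    change g s x ∈ V
    rw [heq]
    exact (ht s hs x).2
  · obtain ⟨s, y, rfl⟩ := DirectedWedge.exists_incl x
    exact hg' s y
  · exact (congrFun hg₀ y₀).trans hG₀

/-- This places the coverings built from cocycles under the control of the maximal covering. -/
theorem isDiskHedgehogCovering_of_isCoveringMap (hp : IsCoveringMap p) : IsDiskHedgehogCovering p := by
  refine ⟨hp.continuous, ?_, ?_⟩
  · rintro H _ ⟨S, _, _, _, z, ⟨φ⟩⟩ f x₀ e₀ h
    obtain ⟨g, hg, hg'⟩ := exists_lift_directedWedge hp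
      (f.comp ⟨φ.symm, φ.symm.continuous⟩) (φ x₀) e₀ (by simpa using h)
    exact ⟨g.comp ⟨φ, φ.continuous⟩, fun x => by simp [hg], by simpa using hg'⟩
  · rintro H _ hH g h hgh ⟨x₀, hx⟩
    have := hH.pathConnectedSpace
    exact DFunLike.coe_injective
      (hp.eq_of_comp_eq g.continuous h.continuous (funext hgh) x₀ hx)

end coveringMap

/-! ### The hedgehog fundamental group as a group of path classes -/

section hedgehog
variable {B : Type u} [TopologicalSpace B]

/-- Parallel loops that are equivalent for the maximal covering are equivalent for every
disk-hedgehog covering. -/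
theorem PeanoCovering.IsMaximal.monodromyRel [PathConnectedSpace B] {P : PeanoCovering B}
    (hP : P.IsMaximal) {E : Type u} [TopologicalSpace E] {q : E → B}
    (hq : IsDiskHedgehogCovering q) {b : B} {α β : Path b b} (h : MonodromyRel P.proj α β) :
    MonodromyRel q α β := by
  refine (monodromyRel_iff _ _ _).2 fun x y y' hy hy' => ?_
  -- Maximality only concerns Peano total spaces, so `q` is replaced by the Peanified path component
  -- of `x`, which still contains the lifts starting at `x`.
  let Q : PeanoCovering B :=
    ⟨PeanoPart x, fun e => q e.val, PeanoPart.isPeano x, PeanoPart.isCovering hq x⟩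
  have : Nonempty P.Total := P.isPeano.connected.toNonempty
  obtain ⟨e₁, he₁⟩ := P.isArcCovering.surjective b
  obtain ⟨-, F, hF, hFe⟩ := hP Q e₁ (PeanoPart.base x) (he₁.trans hy.source.symm)
  have hval : Continuous fun e : P.Total => (F e).val := PeanoPart.continuous_val.comp F.continuous
  have key : ∀ (γ : Path b b) (e : P.Total), PathLifts P.proj γ e₁ e →
      PathLifts q γ x (F e).val := by
    rintro γ e ⟨a, ha⟩
    exact ⟨(a.map hval).cast (by rw [hFe]; rfl) rfl, fun t => (hF (a t)).trans (ha t)⟩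
  obtain ⟨e, he⟩ := P.isArcCovering.exists_pathLifts α he₁
  have he' := ((P.isArcCovering.monodromyRel_iff _ _).1 h e₁ e).1 he
  exact (hq.isArcCovering.pathLifts_unique hy (key α e he)).trans
    (hq.isArcCovering.pathLifts_unique (key β e he') hy')

variable [PathConnectedSpace B]

/-- The class of an arbitrary path in the monodromy group at `b₀`, obtained by joining its end points
to `b₀` by chosen paths. -/
noncomputable def MonodromyGroup.pathClass {E : Type v} [TopologicalSpace E] {p : E → B}
    (hp : IsArcCovering p) (b₀ : B) {a b : B} (α : Path a b) : MonodromyGroup hp b₀ :=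
  MonodromyGroup.mk hp ((PathConnectedSpace.somePath b₀ a).trans
    (α.trans (PathConnectedSpace.somePath b₀ b).symm))

section pathClass
variable {E : Type v} [TopologicalSpace E] {p : E → B} (hp : IsArcCovering p) (b₀ : B)

/-- Lifting along the chosen connecting paths gives bijections between fibres, which can be
cancelled on both sides. -/
theorem MonodromyGroup.pathClass_eq_iff {a b : B} {α β : Path a b} :
    pathClass hp b₀ α = pathClass hp b₀ β ↔ ∀ x y, PathLifts p α x y ↔ PathLifts p β x y := by
  rw [pathClass, pathClass, MonodromyGroup.mk_eq_mk, hp.monodromyRel_iff]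
  constructor
  · have key : ∀ {α β : Path a b}, (∀ x y,
        PathLifts p ((PathConnectedSpace.somePath b₀ a).trans
          (α.trans (PathConnectedSpace.somePath b₀ b).symm)) x y →
        PathLifts p ((PathConnectedSpace.somePath b₀ a).trans
          (β.trans (PathConnectedSpace.somePath b₀ b).symm)) x y) →
        ∀ x y, PathLifts p α x y → PathLifts p β x y := by
      intro α β h x y hxy
      obtain ⟨u, hu⟩ := hp.exists_pathLifts (PathConnectedSpace.somePath b₀ a).symm hxy.source
      obtain ⟨w, hw⟩ := hp.exists_pathLifts (PathConnectedSpace.somePath b₀ b).symm hxy.target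
      rw [pathLifts_symm_iff] at hu
      obtain ⟨x', hx', h'⟩ := hp.pathLifts_trans_iff.1 (h u w (hu.trans (hxy.trans hw)))
      obtain ⟨y', hy', hw'⟩ := hp.pathLifts_trans_iff.1 h'
      obtain rfl := hp.pathLifts_unique hu hx'
      obtain rfl := hp.pathLifts_unique (pathLifts_symm_iff.1 hw) (pathLifts_symm_iff.1 hw')
      exact hy'
    exact fun h x y => ⟨key (fun x y => (h x y).1) x y, key (fun x y => (h x y).2) x y⟩
  · intro h x y
    simp only [hp.pathLifts_trans_iff, h]

/-- The product makes a detour from `b` to `b₀` and back along one chosen path; its lifts return to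
their starting points. -/
theorem MonodromyGroup.pathClass_trans {a b c : B} (α : Path a b) (β : Path b c) :
    pathClass hp b₀ (α.trans β) = pathClass hp b₀ α * pathClass hp b₀ β := by
  refine ((MonodromyGroup.mk_eq_mk hp).2 ((Hedgehog.monodromyRel_iff _ _ _).2
    fun x y y' h h' => ?_)).trans (MonodromyGroup.mk_trans hp _ _)
  obtain ⟨u, hu, h₁⟩ := hp.pathLifts_trans_iff.1 h
  obtain ⟨w, hw, h₂⟩ := hp.pathLifts_trans_iff.1 h₁
  obtain ⟨v, hv, hv'⟩ := hp.pathLifts_trans_iff.1 hw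
  obtain ⟨r, hr⟩ := hp.exists_pathLifts (PathConnectedSpace.somePath b₀ b).symm hv.target
  exact hp.pathLifts_unique
    ((hu.trans (hv.trans hr)).trans ((pathLifts_symm_iff.1 hr).trans (hv'.trans h₂))) h'

/-- Conjugating a representing loop by the chosen path from `b₀` to `a` cancels the conjugation
built into `pathClass`. -/
theorem MonodromyGroup.exists_pathClass_eq (a : B) (g : MonodromyGroup hp b₀) :
    ∃ α : Path a a, pathClass hp b₀ α = g := by
  obtain ⟨γ, rfl⟩ : ∃ γ : Path b₀ b₀, MonodromyGroup.mk hp γ = g :=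
    Quotient.exists_rep (s := monodromySetoid hp b₀) g
  refine ⟨(PathConnectedSpace.somePath b₀ a).symm.trans
    (γ.trans (PathConnectedSpace.somePath b₀ a)), (MonodromyGroup.mk_eq_mk hp).2
      ((Hedgehog.monodromyRel_iff _ _ _).2 fun x y y' h h' => ?_)⟩
  obtain ⟨u, hu⟩ := hp.exists_pathLifts (PathConnectedSpace.somePath b₀ a) h'.source
  obtain ⟨w, hw⟩ := hp.exists_pathLifts (PathConnectedSpace.somePath b₀ a) h'.target
  exact hp.pathLifts_unique h (hu.trans ((hu.symm.trans (h'.trans hw)).trans hw.symm))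

end pathClass

/-- If the inclusions of the stars of an open cover induce trivial homomorphisms, the classes in the
hedgehog fundamental group are adapted to the cover. -/
theorem HedgehogFundamentalGroup.isPathClassMap (𝒰 : Set (Set B)) (hcov : ⋃₀ 𝒰 = Set.univ)
    (hpc : ∀ V ∈ 𝒰, IsPathConnected V)
    (hstar : ∀ x : B,
      haveI : PathConnectedSpace (star x 𝒰) := pathConnectedSpace_star hcov hpc x
      HedgehogFundamentalGroup.map (⟨Subtype.val, continuous_subtype_val⟩ : C(star x 𝒰, B))
        ⟨x, mem_star hcov x⟩ = 1) (b₀ : B) :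
    IsPathClassMap (fun V : 𝒰 => V.1)
      (fun {_ _} α => MonodromyGroup.pathClass (maximalCovering B).isArcCovering b₀ α) where
  map_trans α β := MonodromyGroup.pathClass_trans _ b₀ α β
  exists_eq a g := MonodromyGroup.exists_pathClass_eq _ b₀ a g
  lifts_eq p hp a α β h x y z hy hz := by
    have h₁ : MonodromyRel (maximalCovering B).proj α β :=
      ((maximalCovering B).isArcCovering.monodromyRel_iff _ _).2
        ((MonodromyGroup.pathClass_eq_iff _ b₀).1 h)
    exact (monodromyRel_iff _ _ _).1 ((maximalCovering_isMaximal B).monodromyRel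
      (isDiskHedgehogCovering_of_isCoveringMap hp) h₁) x y z hy hz
  eq_of_mem V W a b α β hα hβ := by
    have hp := (maximalCovering B).isArcCovering
    -- Both members contain the common initial point `a`, so both paths run in the star of `a`, and
    -- `α` followed by the reverse of `β` is a loop there.
    have hαs : ∀ t, α t ∈ star a 𝒰 := fun t => ⟨V.1, ⟨V.2, by simpa using hα 0⟩, hα t⟩
    have hβs : ∀ t, β t ∈ star a 𝒰 := fun t => ⟨W.1, ⟨W.2, by simpa using hβ 0⟩, hβ t⟩
    have hs : ∀ t, α.trans β.symm t ∈ star a 𝒰 := path_trans_mem hαs fun t => hβs _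
    have : PathConnectedSpace (star a 𝒰) := pathConnectedSpace_star hcov hpc a
    let δ : Path (⟨a, mem_star hcov a⟩ : star a 𝒰) ⟨a, mem_star hcov a⟩ :=
      ⟨⟨fun t => ⟨α.trans β.symm t, hs t⟩, by fun_prop⟩, Subtype.ext (Path.source _),
        Subtype.ext (Path.target _)⟩
    have h₁ : MonodromyGroup.mk hp (α.trans β.symm) = MonodromyGroup.mk hp (Path.refl a) :=
      congrArg (fun F => F (MonodromyGroup.mk _ δ)) (hstar a)
    rw [MonodromyGroup.mk_eq_mk, hp.monodromyRel_iff] at h₁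
    -- The loop has trivial class in `B`, so all its lifts to the maximal covering are closed.
    have h₂ : ∀ x y, PathLifts (maximalCovering B).proj (α.trans β.symm) x y → x = y :=
      fun x y h => hp.pathLifts_unique (pathLifts_refl h.source) ((h₁ x y).1 h)
    refine (MonodromyGroup.pathClass_eq_iff _ b₀).2 fun x y => ⟨fun h => ?_, fun h => ?_⟩
    · obtain ⟨z, hz⟩ := hp.exists_pathLifts β.symm h.target
      obtain rfl := h₂ x z (h.trans hz)
      exact pathLifts_symm_iff.1 hz
    · obtain ⟨z, hz⟩ := hp.exists_pathLifts α h.source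
      obtain ⟨w, hw⟩ := hp.exists_pathLifts β.symm hz.target
      obtain rfl := h₂ x w (hz.trans hw)
      obtain rfl := hp.pathLifts_unique h (pathLifts_symm_iff.1 hw)
      exact hz

end hedgehog

end Hedgehog

namespace Hedgehog

/-! ### The fundamental group as a group of path classes -/

section fundamentalGroup
open CategoryTheory

variable {X : Type u} [TopologicalSpace X]

/-- A path as a morphism of the fundamental groupoid. -/
def pathHom {a b : X} (α : Path a b) : FundamentalGroupoid.mk a ⟶ FundamentalGroupoid.mk b :=
  Path.Homotopic.Quotient.mk α

theorem pathHom_trans {a b c : X} (α : Path a b) (β : Path b c) :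
    pathHom (α.trans β) = pathHom α ≫ pathHom β := rfl

theorem pathHom_eq_iff {a b : X} {α β : Path a b} : pathHom α = pathHom β ↔ α.Homotopic β :=
  Path.Homotopic.Quotient.eq

/-- The class of an arbitrary path in the fundamental group at `x₀`, obtained by joining its end
points to `x₀` by chosen paths. The path is reversed since the product of the fundamental group is
composition in the groupoid in the opposite order. -/
noncomputable def fundamentalPathClass [PathConnectedSpace X] (x₀ : X) {a b : X} (α : Path a b) :
    FundamentalGroup X x₀ :=
  pathHom (PathConnectedSpace.somePath x₀ b) ≫ Groupoid.inv (pathHom α) ≫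
    Groupoid.inv (pathHom (PathConnectedSpace.somePath x₀ a))

theorem fundamentalPathClass_eq_iff [PathConnectedSpace X] (x₀ : X) {a b : X} {α β : Path a b} :
    fundamentalPathClass x₀ α = fundamentalPathClass x₀ β ↔ α.Homotopic β := by
  rw [← pathHom_eq_iff]
  refine ⟨fun h => ?_, fun h => by rw [fundamentalPathClass, h]; rfl⟩
  simp only [fundamentalPathClass, Groupoid.inv_eq_inv] at h
  have h₁ := (cancel_epi _).1 h
  exact IsIso.inv_eq_inv.1 ((cancel_mono _).1 h₁)

/-- The classes in the fundamental group are adapted to an open cover by simply connected sets with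
path-connected pairwise intersections. -/
theorem isPathClassMap_fundamentalPathClass [PathConnectedSpace X] {ι : Type u} {U : ι → Set X}
    (hsc : ∀ i, SimplyConnectedSpace (U i))
    (hint : ∀ i j a b, a ∈ U i → a ∈ U j → b ∈ U i → b ∈ U j → JoinedIn (U i ∩ U j) a b) (x₀ : X) :
    IsPathClassMap U (fun {_ _} α => fundamentalPathClass x₀ α) where
  map_trans α β := by
    simp only [fundamentalPathClass, pathHom_trans, Groupoid.inv_eq_inv, IsIso.inv_comp,
      End.mul_def, Category.assoc, IsIso.inv_hom_id_assoc]
  exists_eq a g := by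
    -- The inverse of `g` appears because `fundamentalPathClass` reverses its path.
    obtain ⟨γ, hγ⟩ := Path.Homotopic.Quotient.mk_surjective
      (Groupoid.inv (pathHom (PathConnectedSpace.somePath x₀ a)) ≫
        Groupoid.inv (X := FundamentalGroupoid.mk x₀) (Y := FundamentalGroupoid.mk x₀) g ≫
        pathHom (PathConnectedSpace.somePath x₀ a) :
          FundamentalGroupoid.mk a ⟶ FundamentalGroupoid.mk a)
    refine ⟨γ, ?_⟩
    have hγ' : pathHom γ = _ := hγ
    simp only [fundamentalPathClass, hγ', Groupoid.inv_eq_inv, IsIso.inv_comp, IsIso.inv_inv,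
      Category.assoc, IsIso.hom_inv_id_assoc, IsIso.hom_inv_id, Category.comp_id]
  lifts_eq p hp a α β h x y z hy hz := by
    have hαβ : α.Homotopic β := (fundamentalPathClass_eq_iff x₀).1 h
    have h₁ := IsCoveringMap.liftPath_apply_one_eq_of_homotopicRel hp hαβ x
      (by simpa using hy.source.symm) (by simpa using hy.source.symm)
    obtain ⟨η, hη⟩ := hy
    obtain ⟨ζ, hζ⟩ := hz
    rw [← (IsCoveringMap.eq_liftPath_iff' hp (Γ := η.toContinuousMap) _).2 ⟨funext hη, η.source⟩,
      ← (IsCoveringMap.eq_liftPath_iff' hp (Γ := ζ.toContinuousMap) _).2 ⟨funext hζ, ζ.source⟩]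
      at h₁
    simpa using h₁
  eq_of_mem i j a b α β hα hβ := by
    have key : ∀ k (γ δ : Path a b), (∀ t, γ t ∈ U k) → (∀ t, δ t ∈ U k) → γ.Homotopic δ := by
      intro k γ δ hγ hδ
      have := hsc k
      let lift : ∀ ε : Path a b, (∀ t, ε t ∈ U k) →
          Path (⟨a, by simpa using hγ 0⟩ : U k) ⟨b, by simpa using hγ 1⟩ := fun ε hε =>
        ⟨⟨fun t => ⟨ε t, hε t⟩, by fun_prop⟩, Subtype.ext ε.source, Subtype.ext ε.target⟩
      exact (SimplyConnectedSpace.paths_homotopic (lift γ hγ) (lift δ hδ)).map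
        ⟨Subtype.val, continuous_subtype_val⟩
    -- A path `ε` in the intersection is homotopic to `α` inside `U i` and to `β` inside `U j`.
    obtain ⟨ε, hε⟩ := hint i j a b (by simpa using hα 0) (by simpa using hβ 0)
      (by simpa using hα 1) (by simpa using hβ 1)
    exact (fundamentalPathClass_eq_iff x₀).2
      ((key i α ε hα fun t => (hε t).1).trans (key j ε β (fun t => (hε t).2) hβ))

end fundamentalGroup

/-! ### Open stars of the vertices of a geometric realization -/

section openStar
variable {ι : Type u} {K : PreAbstractSimplicialComplex ι}

theorem convex_closedSimplex (s : Finset ι) : Convex ℝ (closedSimplex s) := by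
  intro x hx y hy a b ha hb hab
  refine ⟨fun i => ?_, fun i hi => by simp [hx.2.1 i hi, hy.2.1 i hi], ?_⟩
  · have := hx.1 i
    have := hy.1 i
    simp only [Pi.add_apply, Pi.smul_apply, smul_eq_mul]
    positivity
  · simp [Finset.sum_add_distrib, ← Finset.mul_sum, hx.2.2, hy.2.2, hab]

theorem mem_of_mem_closedSimplex {s : Finset ι} {t : ι → ℝ} (ht : t ∈ closedSimplex s) {i : ι}
    (hi : 0 < t i) : i ∈ s := by
  by_contra h
  exact hi.ne' (ht.2.1 i h)

open Classical in
theorem single_mem_closedSimplex {s : Finset ι} {i : ι} (hi : i ∈ s) :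
    (Pi.single i 1 : ι → ℝ) ∈ closedSimplex s := by
  refine ⟨fun j => ?_, fun j hj => Pi.single_eq_of_ne (by rintro rfl; exact hj hi) _, ?_⟩
  · by_cases h : j = i
    · subst h; simp
    · simp [h]
  · simp [Finset.sum_pi_single', hi]

theorem GeometricRealization.continuous_incl (s : K.faces) :
    Continuous (GeometricRealization.incl K s) :=
  continuous_iff_coinduced_le.2 (le_iSup
    (fun s : K.faces => TopologicalSpace.coinduced (GeometricRealization.incl K s) inferInstance) s)

theorem GeometricRealization.isOpen_iff {U : Set (GeometricRealization K)} :
    IsOpen U ↔ ∀ s : K.faces, IsOpen (GeometricRealization.incl K s ⁻¹' U) := by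
  refine isOpen_iSup_iff.trans (forall_congr' fun s => ?_)
  exact isOpen_coinduced

/-- The open star of a vertex: the points whose barycentric coordinate at the vertex is positive. -/
def openStar (K : PreAbstractSimplicialComplex ι) (i : ι) : Set (GeometricRealization K) :=
  {t | 0 < t.1 i}

theorem isOpen_openStar (i : ι) : IsOpen (openStar K i) := by
  refine GeometricRealization.isOpen_iff.2 fun s => ?_
  have h : Continuous fun t : closedSimplex s.1 => t.1 i :=
    (continuous_apply i).comp continuous_subtype_val
  exact isOpen_Ioi.preimage h

theorem exists_mem_openStar (t : GeometricRealization K) : ∃ i, t ∈ openStar K i := by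
  obtain ⟨t, s, hs, ht⟩ := t
  by_contra! h
  have h₀ : ∑ i ∈ s, t i = 0 := Finset.sum_eq_zero fun i _ =>
    le_antisymm (not_lt.1 (h i)) (ht.1 i)
  exact one_ne_zero (ht.2.2.symm.trans h₀)

/-- Two points of a closed simplex are joined by a segment. -/
theorem exists_path_segment {x y : GeometricRealization K} {s : Finset ι} (hs : s ∈ K.faces)
    (hx : x.1 ∈ closedSimplex s) (hy : y.1 ∈ closedSimplex s) :
    ∃ α : Path x y, ∀ r i, (α r).1 i = (1 - (r : ℝ)) * x.1 i + (r : ℝ) * y.1 i := by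
  have hmem : ∀ r : I, (1 - (r : ℝ)) • x.1 + (r : ℝ) • y.1 ∈ closedSimplex s := fun r =>
    convex_closedSimplex s hx hy (by linarith [r.2.2]) r.2.1 (by ring)
  have hc : Continuous fun r : I =>
      (⟨(1 - (r : ℝ)) • x.1 + (r : ℝ) • y.1, hmem r⟩ : closedSimplex s) := by fun_prop
  exact ⟨⟨⟨_, (GeometricRealization.continuous_incl ⟨s, hs⟩).comp hc⟩,
    Subtype.ext (by simp [GeometricRealization.incl]),
    Subtype.ext (by simp [GeometricRealization.incl])⟩, fun r i => rfl⟩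

/-- A map on an open star is continuous if its restrictions to all simplices are. -/
theorem continuous_openStar {Y : Type v} [TopologicalSpace Y] {i : ι} {f : openStar K i → Y}
    (h : ∀ s : K.faces, i ∈ s.1 → Continuous fun t : {t : closedSimplex s.1 // 0 < t.1 i} =>
      f ⟨GeometricRealization.incl K s t.1, t.2⟩) : Continuous f := by
  refine ⟨fun V hV => ?_⟩
  rw [(isOpen_openStar i).isOpenEmbedding_subtypeVal.isOpen_iff_image_isOpen]
  refine GeometricRealization.isOpen_iff.2 fun s => ?_
  by_cases his : i ∈ s.1
  · have hpos : IsOpen {t : closedSimplex s.1 | 0 < t.1 i} :=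
      isOpen_Ioi.preimage ((continuous_apply i).comp continuous_subtype_val)
    convert hpos.isOpenEmbedding_subtypeVal.isOpenMap _ (hV.preimage (h s his)) using 1
    ext t
    constructor
    · rintro ⟨y, hy, hyt⟩
      have ht : GeometricRealization.incl K s t ∈ openStar K i := hyt ▸ y.2
      obtain rfl : y = ⟨_, ht⟩ := Subtype.ext hyt
      exact ⟨⟨t, ht⟩, hy, rfl⟩
    · rintro ⟨y, hy, rfl⟩
      exact ⟨_, hy, rfl⟩
  -- A simplex without the vertex `i` misses the open star and imposes no condition.
  · convert isOpen_empty
    refine eq_empty_of_forall_notMem ?_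
    rintro t ⟨y, -, hyt⟩
    have ht : GeometricRealization.incl K s t ∈ openStar K i := hyt ▸ y.2
    exact his (mem_of_mem_closedSimplex t.2 ht)

/-- Open stars are contractible. -/
theorem contractibleSpace_openStar {i : ι} (hi : {i} ∈ K.faces) :
    ContractibleSpace (openStar K i) := by
  classical
  let e : openStar K i := ⟨⟨Pi.single i 1, {i}, hi, single_mem_closedSimplex (by simp)⟩, by
    change 0 < (Pi.single i 1 : ι → ℝ) i
    simp⟩
  have hmem : ∀ (s : Finset ι), i ∈ s → ∀ t ∈ closedSimplex s, ∀ r : I,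
      (1 - (r : ℝ)) • t + (r : ℝ) • (Pi.single i 1 : ι → ℝ) ∈ closedSimplex s := fun s his t ht r =>
    convex_closedSimplex s ht (single_mem_closedSimplex his) (by linarith [r.2.2]) r.2.1 (by ring)
  have hpos : ∀ (t : ι → ℝ), 0 < t i → ∀ r : I,
      0 < ((1 - (r : ℝ)) • t + (r : ℝ) • (Pi.single i 1 : ι → ℝ)) i := by
    intro t ht r
    simp only [Pi.add_apply, Pi.smul_apply, smul_eq_mul, Pi.single_eq_same, mul_one]
    have h₀ := r.2.1
    have h₁ := r.2.2
    rcases h₀.eq_or_lt with h | h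
    · rw [← h]; simpa using ht
    · have : 0 ≤ (1 - (r : ℝ)) * t i := mul_nonneg (by linarith) ht.le
      linarith
  let line : openStar K i → I → openStar K i := fun t r =>
    ⟨⟨(1 - (r : ℝ)) • t.1.1 + (r : ℝ) • (Pi.single i 1 : ι → ℝ), by
      obtain ⟨s, hs, hts⟩ := t.1.2
      exact ⟨s, hs, hmem s (mem_of_mem_closedSimplex hts t.2) _ hts r⟩⟩, hpos _ t.2 r⟩
  have hline : ∀ s : K.faces, i ∈ s.1 →
      Continuous fun q : {t : closedSimplex s.1 // 0 < t.1 i} × I =>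
        line ⟨GeometricRealization.incl K s q.1.1, q.1.2⟩ q.2 := by
    intro s his
    have hc : Continuous fun q : {t : closedSimplex s.1 // 0 < t.1 i} × I =>
        (⟨(1 - (q.2 : ℝ)) • q.1.1.1 + (q.2 : ℝ) • (Pi.single i 1 : ι → ℝ),
          hmem s.1 his _ q.1.1.2 q.2⟩ : closedSimplex s.1) := by fun_prop
    exact ((GeometricRealization.continuous_incl s).comp hc).subtype_mk _
  have hline' : ∀ t, Continuous (line t) := by
    intro t
    obtain ⟨s, hs, hts⟩ := t.1.2
    exact (hline ⟨s, hs⟩ (mem_of_mem_closedSimplex hts t.2)).comp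
      (Continuous.prodMk_right (⟨⟨t.1.1, hts⟩, t.2⟩ : {t : closedSimplex s // 0 < t.1 i}))
  -- Joint continuity of the contraction on star times interval is not visible simplex by simplex.
  -- As a map into the path space `C(I, _)`, the contraction can be tested on simplices by
  -- `continuous_openStar`, and evaluation recovers the homotopy.
  let F : openStar K i → C(I, openStar K i) := fun t => ⟨line t, hline' t⟩
  have hF : Continuous F := continuous_openStar fun s his =>
    (ContinuousMap.curry ⟨_, hline s his⟩).continuous
  refine (contractible_iff_id_nullhomotopic _).2 ⟨e, ⟨⟨⟨fun q => F q.2 q.1, ?_⟩, ?_, ?_⟩⟩⟩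
  · exact continuous_eval.comp ((hF.comp continuous_snd).prodMk continuous_fst)
  · intro t
    exact Subtype.ext (Subtype.ext (by simp [F, line]))
  · intro t
    exact Subtype.ext (Subtype.ext (by simp [F, line, e]))

/-- The midpoint of the edge `i j` (the vertex itself if `i = j`) lies in every simplex containing
both vertices. Segments towards it keep both coordinates positive. -/
theorem joinedIn_openStar_inter {i j : ι} {x y : GeometricRealization K} (hxi : x ∈ openStar K i)
    (hxj : x ∈ openStar K j) (hyi : y ∈ openStar K i) (hyj : y ∈ openStar K j) :
    JoinedIn (openStar K i ∩ openStar K j) x y := by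
  classical
  let m : ι → ℝ := (1 / 2 : ℝ) • Pi.single i 1 + (1 / 2 : ℝ) • Pi.single j 1
  have hm : ∀ {s : Finset ι}, i ∈ s → j ∈ s → m ∈ closedSimplex s := fun hi hj =>
    convex_closedSimplex _ (single_mem_closedSimplex hi) (single_mem_closedSimplex hj)
      (by norm_num) (by norm_num) (by norm_num)
  have hmi : 0 < m i ∧ 0 < m j := by
    by_cases h : i = j
    · subst h; simp [m]
    · simp [m, h, Ne.symm h]
  have key : ∀ z : GeometricRealization K, z ∈ openStar K i → z ∈ openStar K j →
      ∃ w : GeometricRealization K, w.1 = m ∧ JoinedIn (openStar K i ∩ openStar K j) z w := by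
    intro z hi hj
    obtain ⟨s, hs, hz⟩ := z.2
    have hms := hm (mem_of_mem_closedSimplex hz hi) (mem_of_mem_closedSimplex hz hj)
    let w : GeometricRealization K := ⟨m, s, hs, hms⟩
    obtain ⟨α, hα⟩ := exists_path_segment (x := z) (y := w) hs hz hms
    have hpos : ∀ (r : I) (k : ι), 0 < z.1 k → 0 < m k → 0 < (α r).1 k := by
      intro r k hzk hmk
      rw [hα]
      have h₀ := r.2.1
      have h₁ := r.2.2
      rcases h₀.eq_or_lt with h | h
      · rw [← h]; simpa using hzk
      · have := mul_nonneg (sub_nonneg.2 h₁) hzk.le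
        have := mul_pos h hmk
        dsimp only [w]
        linarith
    exact ⟨w, rfl, α, fun r => ⟨hpos r i hi hmi.1, hpos r j hj hmi.2⟩⟩
  obtain ⟨w, hw, h⟩ := key x hxi hxj
  obtain ⟨w', hw', h'⟩ := key y hyi hyj
  obtain rfl : w = w' := Subtype.ext (hw.trans hw'.symm)
  exact h.trans h'.symm

/-- Positive coordinates force a vertex into any simplex carrying the point; conversely, the
barycentre of a simplex lies in the open stars of all its vertices. -/
theorem meet_openStar_iff {i j k : ι} :
    Meet (openStar K) i j k ↔ ∃ s ∈ K.faces, i ∈ s ∧ j ∈ s ∧ k ∈ s := by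
  constructor
  · rintro ⟨x, hi, hj, hk⟩
    obtain ⟨s, hs, hx⟩ := x.2
    exact ⟨s, hs, mem_of_mem_closedSimplex hx hi, mem_of_mem_closedSimplex hx hj,
      mem_of_mem_closedSimplex hx hk⟩
  · rintro ⟨s, hs, hi, hj, hk⟩
    classical
    let m : ι → ℝ := fun l => if l ∈ s then (s.card : ℝ)⁻¹ else 0
    have hc : 0 < (s.card : ℝ) := by exact_mod_cast Finset.card_pos.2 ⟨i, hi⟩
    have hm : m ∈ closedSimplex s := by
      refine ⟨fun l => ?_, fun l hl => if_neg hl, ?_⟩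
      · dsimp only [m]
        split_ifs <;> positivity
      · rw [Finset.sum_congr rfl fun l hl => if_pos hl, Finset.sum_const, nsmul_eq_mul,
          mul_inv_cancel₀ hc.ne']
    have hpos : ∀ l ∈ s, 0 < m l := fun l hl => by
      dsimp only [m]
      rw [if_pos hl]
      positivity
    exact ⟨⟨m, _, hs, hm⟩, hpos i hi, hpos j hj, hpos k hk⟩

end openStar

end Hedgehog

namespace Hedgehog

/-! ### The nerve of an open cover -/

section nerve
variable {B : Type u} {𝒰 : Set (Set B)}

/-- The two universal problems become literally the same one; this is the only place where the
definition of the simplices of the nerve is compared with triple intersections in `B`. -/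
theorem meet_openStar_nerve : Meet (openStar (nerve 𝒰)) = Meet (fun V : 𝒰 => V.1) := by
  funext U V W
  refine propext (meet_openStar_iff.trans ⟨?_, ?_⟩)
  · rintro ⟨s, ⟨-, x, hx⟩, hU, hV, hW⟩
    exact ⟨x, hx U hU, hx V hV, hx W hW⟩
  · rintro ⟨x, hU, hV, hW⟩
    classical
    refine ⟨{U, V, W}, ⟨⟨U, by simp⟩, x, fun Z hZ => ?_⟩, by simp, by simp, by simp⟩
    simp only [Finset.mem_insert, Finset.mem_singleton] at hZ
    rcases hZ with rfl | rfl | rfl <;> assumption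

variable [TopologicalSpace B]

theorem singleton_mem_nerve_faces (hpc : ∀ V ∈ 𝒰, IsPathConnected V) (V : 𝒰) :
    {V} ∈ (nerve 𝒰).faces := by
  obtain ⟨x, hx⟩ := (hpc V.1 V.2).nonempty
  exact ⟨⟨V, by simp⟩, x, fun W hW => by rwa [Finset.mem_singleton.1 hW]⟩

/-- The nerve of an open cover of a path-connected space by path-connected sets is
path-connected. -/
theorem pathConnectedSpace_nerve [PathConnectedSpace B] (hopen : ∀ V ∈ 𝒰, IsOpen V)
    (hcov : ⋃₀ 𝒰 = Set.univ) (hpc : ∀ V ∈ 𝒰, IsPathConnected V) :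
    PathConnectedSpace (GeometricRealization (nerve 𝒰)) := by
  have hcov' : ∀ x : B, ∃ V : 𝒰, x ∈ V.1 := fun x => by
    obtain ⟨V, hV, hx⟩ := (hcov.symm ▸ mem_univ x : x ∈ ⋃₀ 𝒰)
    exact ⟨⟨V, hV⟩, hx⟩
  have hstar : ∀ (V : 𝒰) {x y}, x ∈ openStar (nerve 𝒰) V → y ∈ openStar (nerve 𝒰) V →
      Joined x y := fun V _ _ hx hy => (joinedIn_openStar_inter hx hx hy hy).joined
  have hedge : ∀ (V W : 𝒰) (a : B), a ∈ V.1 → a ∈ W.1 → ∀ {x y}, x ∈ openStar (nerve 𝒰) V →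
      y ∈ openStar (nerve 𝒰) W → Joined x y := by
    intro V W a hV hW x y hx hy
    have h : Meet (openStar (nerve 𝒰)) V W W := by
      rw [meet_openStar_nerve]
      exact ⟨a, hV, hW, hW⟩
    obtain ⟨z, hzV, hzW, -⟩ := h
    exact (hstar V hx hzV).trans (hstar W hzW hy)
  have hne : ∀ V : 𝒰, ∃ x, x ∈ openStar (nerve 𝒰) V := by
    intro V
    obtain ⟨a, ha⟩ := (hpc V.1 V.2).nonempty
    have h : Meet (openStar (nerve 𝒰)) V V V := by
      rw [meet_openStar_nerve]
      exact ⟨a, ha, ha, ha⟩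
    exact h.imp fun _ h => h.1
  -- A path in `B`, subdivided along the cover, passes through successively meeting members, hence
  -- links successively meeting open stars in the nerve.
  have key : ∀ {a b : B} (_ : Path a b) (V W : 𝒰), a ∈ V.1 → b ∈ W.1 → ∀ {x y},
      x ∈ openStar (nerve 𝒰) V → y ∈ openStar (nerve 𝒰) W → Joined x y := by
    intro a b α
    refine path_induction (U := fun V : 𝒰 => V.1) (fun V => hopen V.1 V.2) hcov'
      (P := fun {a b} _ => ∀ V W : 𝒰, a ∈ V.1 → b ∈ W.1 → ∀ {x y},
        x ∈ openStar (nerve 𝒰) V → y ∈ openStar (nerve 𝒰) W → Joined x y) ?_ ?_ α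
    · intro Z a b α hα V W ha hb x y hx hy
      obtain ⟨z, hz⟩ := hne Z
      exact (hedge V Z a ha (by simpa using hα 0) hx hz).trans
        (hedge Z W b (by simpa using hα 1) hb hz hy)
    · intro a b c α β hα hβ V W ha hc x y hx hy
      obtain ⟨Z, hZ⟩ := hcov' b
      obtain ⟨z, hz⟩ := hne Z
      exact (hα V Z ha hZ hx hz).trans (hβ Z W hZ hc hz hy)
  obtain ⟨b⟩ := (inferInstance : Nonempty B)
  obtain ⟨V, -⟩ := hcov' b
  refine ⟨(hne V).nonempty, fun x y => ?_⟩
  obtain ⟨V, hV⟩ := exists_mem_openStar x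
  obtain ⟨W, hW⟩ := exists_mem_openStar y
  obtain ⟨a, ha⟩ := (hpc V.1 V.2).nonempty
  obtain ⟨b, hb⟩ := (hpc W.1 W.2).nonempty
  exact key (PathConnectedSpace.somePath a b) V W ha hb hV hW

end nerve

end Hedgehog

theorem mainTheorem5 {B : Type u} [TopologicalSpace B] [PathConnectedSpace B] [ParacompactSpace B]
    (𝒰 : Set (Set B)) (hopen : ∀ V ∈ 𝒰, IsOpen V) (hcov : ⋃₀ 𝒰 = Set.univ)
    (hpc : ∀ V ∈ 𝒰, IsPathConnected V)
    (hstar : ∀ x : B,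
      haveI : PathConnectedSpace (Hedgehog.star x 𝒰) := Hedgehog.pathConnectedSpace_star hcov hpc x
      Hedgehog.HedgehogFundamentalGroup.map
        (⟨Subtype.val, continuous_subtype_val⟩ : C(Hedgehog.star x 𝒰, B))
        ⟨x, Hedgehog.mem_star hcov x⟩ = 1)
    (b₀ : B) (v : Hedgehog.GeometricRealization (Hedgehog.nerve 𝒰)) :
    Nonempty (Hedgehog.HedgehogFundamentalGroup B b₀ ≃*
      FundamentalGroup (Hedgehog.GeometricRealization (Hedgehog.nerve 𝒰)) v) := by
  have := Hedgehog.pathConnectedSpace_nerve hopen hcov hpc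
  have hcov' : ∀ x : B, ∃ V : 𝒰, x ∈ V.1 := fun x => by
    obtain ⟨V, hV, hx⟩ := (hcov.symm ▸ mem_univ x : x ∈ ⋃₀ 𝒰)
    exact ⟨⟨V, hV⟩, hx⟩
  have hsc : ∀ V : 𝒰, SimplyConnectedSpace (Hedgehog.openStar (Hedgehog.nerve 𝒰) V) := fun V => by
    have := Hedgehog.contractibleSpace_openStar (Hedgehog.singleton_mem_nerve_faces hpc V)
    infer_instance
  obtain ⟨g, hg⟩ := (Hedgehog.HedgehogFundamentalGroup.isPathClassMap 𝒰 hcov hpc hstar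
    b₀).exists_isUniversalCocycle (fun V => hopen V.1 V.2) hcov' fun V => hpc V.1 V.2
  obtain ⟨g', hg'⟩ := (Hedgehog.isPathClassMap_fundamentalPathClass hsc
    (fun _ _ _ _ h₁ h₂ h₃ h₄ => Hedgehog.joinedIn_openStar_inter h₁ h₂ h₃ h₄)
    v).exists_isUniversalCocycle Hedgehog.isOpen_openStar Hedgehog.exists_mem_openStar fun V =>
      isPathConnected_iff_pathConnectedSpace.2 inferInstance
  rw [Hedgehog.meet_openStar_nerve] at hg'
  -- Both cocycles are universal at every index, so any `V` serves and needs no relation to `v`.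
  obtain ⟨V, -⟩ := hcov' b₀
  exact (hg V).nonempty_mulEquiv (hg' V)
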